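/- Let $K$ be a field, $n\ge 0$, $K[\mathbb X]=K[x_1,\dots,x_n]$, and write $\mathbb T^n_{\le d}$, $\mathbb T^n_{=d}$ for the sets of terms (monic monomials) of total degree at most, respectively equal to, $d$ (so $\mathbb T^n_{\le -1}=\emptyset$). An *order ideal* is a finite set $\mathcal O$ of terms closed under divisors; its border is $\partial\mathcal O=\{x_jt : 1\le j\le n,\ t\in\mathcal O\}\setminus\mathcal O$, with $\partial\emptyset=\{1\}$. For an ideal $I$, an *$\mathcal O$-border basis* of $I$ is a set $\mathcal G=\{b-\sum_{t\in\mathcal O}\alpha_{t,b}\,t : b\in\partial\mathcal O\}$ with $\alpha_{t,b}\in K$, such that $\mathcal G$ generates $I$ and $K[\mathbb X]=I\oplus\langle\mathcal O\rangle_K$. Let $\Lambda(I)$ be the set of order ideals $\mathcal O$ for which $I$ has an $\mathcal O$-border basis. Let $\sigma$ be a degree-compatible term ordering with leading terms $\mathrm{LT}$ and leading coefficients $\mathrm{LC}$. For a finite set $W$ of polynomials put $W^+=W\cup Wx_1\cup\dots\cup Wx_n$, and for $M\subseteq K[\mathbb X]$ put $M^{\le d}=\{g\in M:\deg g\le d\}$.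 **GaussEl$(V,G)$:** start with $W=\emptyset$ and $H=G$. While $H\neq\emptyset$, remove an arbitrary $f$ from $H$; as long as $f\ne0$ and some $v\in V\cup W$ has $\mathrm{LT}(v)=\mathrm{LT}(f)$, replace $f$ by $f-\mathrm{LC}(f)v$; if finally $f\ne 0$, add $f/\mathrm{LC}(f)$ to $W$. Return $W$. **LStabSpan$(F,d)$:** let $V=\mathrm{GaussEl}(\emptyset,F)$. Repeat: $W=\{w\in\mathrm{GaussEl}(V,V^+\setminus V):\deg w\le d\}$; if $W\ne\emptyset$ replace $V$ by $V\cup W$, otherwise return $V$. **BasisTransformation$(M,\mathcal O)$:** let $\ell=\max_{m\in M}\deg m$ ($0$ if $M=\emptyset$). Arrange the terms in $\mathbb T^n_{\le\ell}$ in any order as columns such that those in $\mathcal O$ are to the right of all others; the *head* of a nonzero polynomial supported on these columns is its left-most term. Bring $M$ into reduced row echelon form: first run $\mathrm{GaussEl}(\emptyset,M)$ with heads in place of leading terms, then, as long as there are distinct rows $g,h$ such that the head of $h$ occurs in $g$ with coefficient $c\ne 0$, replace $g$ by $g-ch$. Return the rows whose head is in $\partial\mathcal O$. **Generalized border basis algorithm**,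 with input a finite set $F\subseteq K[\mathbb X]$: 1. $d:=\max_{f\in F}\deg f$ (where $\deg 0=0$, and $d:=0$ if $F=\emptyset$). 2. $M:=\mathrm{LStabSpan}(F,d)$. 3. If $\mathbb T^n_{=d}\not\subseteq\mathrm{LT}(M)$, put $d:=d+1$ and go to 2. 4. Put $d_{\mathrm{old}}:=d$ and $d:=|\mathbb T^n_{\le d_{\mathrm{old}}}|-|M|$. If $d\le d_{\mathrm{old}}$, let $M:=M^{\le d}$; otherwise let $M:=\mathrm{LStabSpan}(F,d)$. 5. Choose any $\mathcal O\in\Lambda(\langle M\rangle)$, where $\langle M\rangle$ is the ideal generated by $M$. 6. Output $\mathcal G:=\mathrm{BasisTransformation}(M,\mathcal O)$. For a finite set $M'$ of polynomials supported on $L=\mathbb T^n_{\le d-1}$, let $P(M',L)\subseteq\mathbb R^L$ be the polytope of all $z\in[0,1]^L$ such that $z_{m_1}\ge z_{m_2}$ whenever $m_1\mid m_2$ in $L$; $\sum_{m\in L}z_m=d$; and $\sum_{m\in U}z_m\ge|U|-\operatorname{rk}\tilde U$ for all $U\subseteq L$ with $|U|=|M'|$, where $\tilde U$ is the submatrix of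 the coefficient matrix of $M'$ with columns $U$. **Proposition 4.4.** Let $F\subseteq K[\mathbb X]$ be a finite set generating a zero-dimensional ideal $I$, i.e. $\dim_K K[\mathbb X]/I<\infty$. Then, for all choices made during the run, the algorithm terminates after finitely many steps and never gets stuck. Whenever it reaches step 5, $d=\dim_K K[\mathbb X]/I$ and $\langle M\rangle=I$; thus the possible choices are exactly the $\mathcal O\in\Lambda(I)$, and these are exactly the sets $\{m\in L: z_m=1\}$ for the integral points $z$ of $P(M^{\le d-1},L)$, $L=\mathbb T^n_{\le d-1}$. For every $\mathcal O\in\Lambda(I)$, the ideal $I$ has a unique $\mathcal O$-border basis $\mathcal G$; there are runs that choose $\mathcal O$, and all of them output $\mathcal G$. -/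

import Mathlib

/-! Terms `x^a` are represented by their exponent vectors `a : Fin n →₀ ℕ`; divisibility of terms is
the pointwise order `≤`, and `a.degree` is the total degree of `x^a`. -/

namespace BorderBasis

open MvPolynomial

/-- The finite set of terms of total degree `< d`. -/
def termsLT (n d : ℕ) : Finset (Fin n →₀ ℕ) :=
  (Finset.range d).biUnion fun k => (Finset.univ : Finset (Fin n)).finsuppAntidiag k

theorem mem_termsLT {n d : ℕ} {a : Fin n →₀ ℕ} : a ∈ termsLT n d ↔ a.degree < d := by
  simp [termsLT, Finset.mem_finsuppAntidiag, Finsupp.degree_eq_sum]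

/-- The finite set of terms of total degree `≤ d`. -/
def termsLE (n d : ℕ) : Finset (Fin n →₀ ℕ) := termsLT n (d + 1)

/-- An order ideal: a (finite) set of terms that is closed under divisors. -/
def IsOrderIdeal {n : ℕ} (O : Finset (Fin n →₀ ℕ)) : Prop :=
  ∀ t ∈ O, ∀ t' : Fin n →₀ ℕ, t' ≤ t → t' ∈ O

/-- The border `{x_j t | t ∈ O} \ O` of an order ideal, with the convention `∂∅ = {1}`. -/
noncomputable def border {n : ℕ} (O : Finset (Fin n →₀ ℕ)) : Finset (Fin n →₀ ℕ) :=
  if O = ∅ then {0}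
  else (O.biUnion fun t => Finset.univ.image fun j : Fin n => t + Finsupp.single j 1) \ O

section Field

variable {K : Type*} [Field K] {n : ℕ}

open Classical in
/-- `G` is an `O`-border basis of the ideal `I`. -/
structure IsBorderBasis (I : Ideal (MvPolynomial (Fin n) K)) (O : Finset (Fin n →₀ ℕ))
    (G : Finset (MvPolynomial (Fin n) K)) : Prop where
  isOrderIdeal : IsOrderIdeal O
  form : ∃ α : (Fin n →₀ ℕ) → (Fin n →₀ ℕ) → K,
    G = (border O).image fun b => monomial b 1 - ∑ t ∈ O, monomial t (α t b)
  span_eq : Ideal.span (G : Set (MvPolynomial (Fin n) K)) = I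
  isCompl : IsCompl (I.restrictScalars K)
    (Submodule.span K ((fun t => monomial t (1 : K)) '' (O : Set (Fin n →₀ ℕ))))

/-- `Λ(I)`: the order ideals that support a border basis of `I` (the admissible order ideals). -/
def admissible (I : Ideal (MvPolynomial (Fin n) K)) : Set (Finset (Fin n →₀ ℕ)) :=
  {O | ∃ G, IsBorderBasis I O G}

open Classical in
/-- The neighbourhood extension `W ∪ W x_1 ∪ ⋯ ∪ W x_n` of a finite set of polynomials. -/
noncomputable def neighborhood (W : Finset (MvPolynomial (Fin n) K)) :
    Finset (MvPolynomial (Fin n) K) :=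
  W ∪ Finset.univ.biUnion fun j : Fin n => W.image fun w => w * X j

end Field

/-! ### Gaussian elimination for polynomials -/

/-- A configuration of `GaussEl(V, G)`: the input `V`, the set `W` of polynomials appended so far,
the set `H` of polynomials still to be treated, and the polynomial `f` in work, if any. -/
structure GaussState (K : Type*) [Field K] (n : ℕ) where
  V : Finset (MvPolynomial (Fin n) K)
  W : Finset (MvPolynomial (Fin n) K)
  H : Finset (MvPolynomial (Fin n) K)
  cur : Option (MvPolynomial (Fin n) K)

section Gauss

variable {K : Type*} [Field K] {n : ℕ}

/-- The initial configuration of `GaussEl(V, G)`. -/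
def GaussState.start (V G : Finset (MvPolynomial (Fin n) K)) : GaussState K n :=
  ⟨V, ∅, G, none⟩

/-- The elimination stops when nothing is left to be treated, and returns the appended set. -/
def GaussState.Returns (s : GaussState K n) (W : Finset (MvPolynomial (Fin n) K)) : Prop :=
  s.H = ∅ ∧ s.cur = none ∧ s.W = W

open Classical in
/-- One step of the elimination, where `hd f` is the leading term (or head) of `f ≠ 0`.
The choice of `f` in `H` is arbitrary. -/
inductive GaussStep (hd : MvPolynomial (Fin n) K → (Fin n →₀ ℕ)) :
    GaussState K n → GaussState K n → Prop
  | pick (V W H : Finset (MvPolynomial (Fin n) K)) (f : MvPolynomial (Fin n) K) :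
      f ∈ H → GaussStep hd ⟨V, W, H, none⟩ ⟨V, W, H.erase f, some f⟩
  | reduce (V W H : Finset (MvPolynomial (Fin n) K)) (f v : MvPolynomial (Fin n) K) :
      f ≠ 0 → v ∈ V ∪ W → hd f = hd v →
      GaussStep hd ⟨V, W, H, some f⟩ ⟨V, W, H, some (f - C (coeff (hd f) f) * v)⟩
  | append (V W H : Finset (MvPolynomial (Fin n) K)) (f : MvPolynomial (Fin n) K) :
      f ≠ 0 → (∀ v ∈ V ∪ W, hd f ≠ hd v) →
      GaussStep hd ⟨V, W, H, some f⟩ ⟨V, insert (C (coeff (hd f) f)⁻¹ * f) W, H, none⟩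
  | drop (V W H : Finset (MvPolynomial (Fin n) K)) :
      GaussStep hd ⟨V, W, H, some 0⟩ ⟨V, W, H, none⟩

end Gauss

/-! ### Computation of the stable span in the universe of terms of degree at most `d` -/

/-- A configuration of `LStabSpan`: inside the first elimination, inside the elimination that
extends the current set `V` by its neighbourhood extension, or finished. -/
inductive StabState (K : Type*) [Field K] (n : ℕ)
  | init (s : GaussState K n)
  | extend (V : Finset (MvPolynomial (Fin n) K)) (s : GaussState K n)
  | ret (V : Finset (MvPolynomial (Fin n) K))

section Stab

variable {K : Type*} [Field K] {n : ℕ}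

/-- `LStabSpan(F, ·)` begins with `GaussEl(∅, F)`. -/
def StabState.start (F : Finset (MvPolynomial (Fin n) K)) : StabState K n :=
  .init (GaussState.start ∅ F)

open Classical in
/-- The configuration in which `GaussEl(V, V⁺ \ V)` is called. -/
noncomputable def StabState.call (V : Finset (MvPolynomial (Fin n) K)) : StabState K n :=
  .extend V (GaussState.start V (neighborhood V \ V))

open Classical in
/-- One step of `LStabSpan` for the terms of degree at most `d`, with leading terms taken with
respect to the term ordering `σ`. -/
inductive StabStep (σ : MonomialOrder (Fin n)) (d : ℕ) : StabState K n → StabState K n → Prop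
  | init_step (s s' : GaussState K n) :
      GaussStep σ.degree s s' → StabStep σ d (.init s) (.init s')
  | init_ret (s : GaussState K n) (V : Finset (MvPolynomial (Fin n) K)) :
      s.Returns V → StabStep σ d (.init s) (.call V)
  | extend_step (V : Finset (MvPolynomial (Fin n) K)) (s s' : GaussState K n) :
      GaussStep σ.degree s s' → StabStep σ d (.extend V s) (.extend V s')
  | extend_more (V W' : Finset (MvPolynomial (Fin n) K)) (s : GaussState K n) :
      s.Returns W' → (W'.filter fun w => w.totalDegree ≤ d).Nonempty →
      StabStep σ d (.extend V s) (.call (V ∪ W'.filter fun w => w.totalDegree ≤ d))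
  | extend_done (V W' : Finset (MvPolynomial (Fin n) K)) (s : GaussState K n) :
      s.Returns W' → (W'.filter fun w => w.totalDegree ≤ d) = ∅ →
      StabStep σ d (.extend V s) (.ret V)

end Stab

/-! ### Basis transformation -/

/-- A configuration of `BasisTransformation(M, O)`: before the columns are ordered, inside the
forward elimination, inside the back substitution on the rows `R`, or finished. `cols` is the list
of column terms from left to right. -/
inductive TransState (K : Type*) [Field K] (n : ℕ)
  | start (M : Finset (MvPolynomial (Fin n) K))
  | forward (cols : List (Fin n →₀ ℕ)) (s : GaussState K n)
  | back (cols : List (Fin n →₀ ℕ)) (R : Finset (MvPolynomial (Fin n) K))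
  | ret (G : Finset (MvPolynomial (Fin n) K))

section Trans

variable {K : Type*} [Field K] {n : ℕ}

/-- The head of a polynomial: its left-most term (used for nonzero polynomials all of whose terms
are among the columns). -/
def head (cols : List (Fin n →₀ ℕ)) (p : MvPolynomial (Fin n) K) : Fin n →₀ ℕ :=
  (cols.find? fun t => decide (t ∈ p.support)).getD 0

open Classical in
/-- One step of `BasisTransformation(·, O)`: arrange the terms of degree at most
`ℓ = max_{m ∈ M} deg m` as columns with those of `O` to the right of all others (in any such
order), bring the matrix into reduced row echelon form (elimination with monic heads, then back
substitution, until no head of a row occurs in another row), and return the rows with head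
in the border of `O`. -/
inductive TransStep (O : Finset (Fin n →₀ ℕ)) : TransState K n → TransState K n → Prop
  | permute (M : Finset (MvPolynomial (Fin n) K)) (cols : List (Fin n →₀ ℕ)) :
      cols.Nodup → cols.toFinset = termsLE n (M.sup totalDegree) →
      cols.Pairwise (fun a b => a ∈ O → b ∈ O) →
      TransStep O (.start M) (.forward cols (GaussState.start ∅ M))
  | forward_step (cols : List (Fin n →₀ ℕ)) (s s' : GaussState K n) :
      GaussStep (head cols) s s' → TransStep O (.forward cols s) (.forward cols s')
  | forward_ret (cols : List (Fin n →₀ ℕ)) (s : GaussState K n)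
      (R : Finset (MvPolynomial (Fin n) K)) :
      s.Returns R → TransStep O (.forward cols s) (.back cols R)
  | back_step (cols : List (Fin n →₀ ℕ)) (R : Finset (MvPolynomial (Fin n) K))
      (g h : MvPolynomial (Fin n) K) :
      g ∈ R → h ∈ R → g ≠ h → head cols h ∈ g.support →
      TransStep O (.back cols R)
        (.back cols (insert (g - C (coeff (head cols h) g) * h) (R.erase g)))
  | back_ret (cols : List (Fin n →₀ ℕ)) (R : Finset (MvPolynomial (Fin n) K)) :
      (∀ g ∈ R, ∀ h ∈ R, g ≠ h → head cols h ∉ g.support) →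
      TransStep O (.back cols R) (.ret (R.filter fun g => head cols g ∈ border O))

end Trans

/-! ### The generalized border basis algorithm -/

/-- A configuration of the generalized border basis algorithm: inside the stable span computation
of the main loop, before the test that ends the loop, before the adjustment of `d`, inside the
stable span computation for the adjusted `d`, before the choice of the order ideal, inside the basis
transformation for the chosen `O`, or finished with output `G` for the chosen `O`. -/
inductive AlgState (K : Type*) [Field K] (n : ℕ)
  | span (d : ℕ) (s : StabState K n)
  | test (d : ℕ) (M : Finset (MvPolynomial (Fin n) K))
  | adjust (d : ℕ) (M : Finset (MvPolynomial (Fin n) K))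
  | respan (d : ℕ) (s : StabState K n)
  | choose (d : ℕ) (M : Finset (MvPolynomial (Fin n) K))
  | transform (O : Finset (Fin n →₀ ℕ)) (s : TransState K n)
  | done (O : Finset (Fin n →₀ ℕ)) (G : Finset (MvPolynomial (Fin n) K))

section Alg

variable {K : Type*} [Field K] {n : ℕ}

/-- The algorithm begins with `d = max_{f ∈ F} deg f` (and `d = 0` if `F = ∅`). -/
noncomputable def AlgState.start (F : Finset (MvPolynomial (Fin n) K)) : AlgState K n :=
  .span (F.sup totalDegree) (StabState.start F)

/-- All terms of degree `d` are leading terms of elements of `M`. -/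
def TopCovered (σ : MonomialOrder (Fin n)) (d : ℕ) (M : Finset (MvPolynomial (Fin n) K)) : Prop :=
  ∀ t : Fin n →₀ ℕ, t.degree = d → ∃ g ∈ M, g ≠ 0 ∧ σ.degree g = t

/-- One step of the generalized border basis algorithm with input `F`. -/
inductive AlgStep (σ : MonomialOrder (Fin n)) (F : Finset (MvPolynomial (Fin n) K)) :
    AlgState K n → AlgState K n → Prop
  | span_step (d : ℕ) (s s' : StabState K n) :
      StabStep σ d s s' → AlgStep σ F (.span d s) (.span d s')
  | span_ret (d : ℕ) (M : Finset (MvPolynomial (Fin n) K)) :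
      AlgStep σ F (.span d (.ret M)) (.test d M)
  | test_fail (d : ℕ) (M : Finset (MvPolynomial (Fin n) K)) :
      ¬ TopCovered σ d M → AlgStep σ F (.test d M) (.span (d + 1) (StabState.start F))
  | test_pass (d : ℕ) (M : Finset (MvPolynomial (Fin n) K)) :
      TopCovered σ d M → AlgStep σ F (.test d M) (.adjust d M)
  | adjust_le (dold d : ℕ) (M : Finset (MvPolynomial (Fin n) K)) :
      d = (termsLE n dold).card - M.card → d ≤ dold →
      AlgStep σ F (.adjust dold M) (.choose d (M.filter fun g => g.totalDegree ≤ d))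
  | adjust_gt (dold d : ℕ) (M : Finset (MvPolynomial (Fin n) K)) :
      d = (termsLE n dold).card - M.card → dold < d →
      AlgStep σ F (.adjust dold M) (.respan d (StabState.start F))
  | respan_step (d : ℕ) (s s' : StabState K n) :
      StabStep σ d s s' → AlgStep σ F (.respan d s) (.respan d s')
  | respan_ret (d : ℕ) (M : Finset (MvPolynomial (Fin n) K)) :
      AlgStep σ F (.respan d (.ret M)) (.choose d M)
  | choose (d : ℕ) (M : Finset (MvPolynomial (Fin n) K)) (O : Finset (Fin n →₀ ℕ)) :
      O ∈ admissible (Ideal.span (M : Set (MvPolynomial (Fin n) K))) →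
      AlgStep σ F (.choose d M) (.transform O (.start M))
  | transform_step (O : Finset (Fin n →₀ ℕ)) (s s' : TransState K n) :
      TransStep O s s' → AlgStep σ F (.transform O s) (.transform O s')
  | transform_ret (O : Finset (Fin n →₀ ℕ)) (G : Finset (MvPolynomial (Fin n) K)) :
      AlgStep σ F (.transform O (.ret G)) (.done O G)

/-- The configuration `s` occurs in some run of the algorithm with input `F`. -/
def Reachable (σ : MonomialOrder (Fin n)) (F : Finset (MvPolynomial (Fin n) K))
    (s : AlgState K n) : Prop :=
  Relation.ReflTransGen (AlgStep σ F) (AlgState.start F) s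

/-- Every run of the algorithm with input `F` is finite. -/
def Terminates (σ : MonomialOrder (Fin n)) (F : Finset (MvPolynomial (Fin n) K)) : Prop :=
  Acc (fun s' s => AlgStep σ F s s') (AlgState.start F)

/-- The integral points of the order ideal polytope `P(M, L)`, where `L` is the set of terms of
degree at most `d - 1`. The matrix is the submatrix with columns `U` of the coefficient matrix
of `M`. -/
def polytopeIntegralPoints (d : ℕ) (M : Finset (MvPolynomial (Fin n) K)) :
    Set (termsLT n d → ℝ) :=
  {z | (∀ a b : termsLT n d, (a : Fin n →₀ ℕ) ≤ b → z b ≤ z a) ∧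
    ∑ a, z a = d ∧
    (∀ U : Finset (termsLT n d), U.card = M.card →
      (U.card : ℝ) - ((Matrix.of fun (g : M) (u : U) =>
        coeff (u : termsLT n d).1 (g : MvPolynomial (Fin n) K)).rank : ℝ) ≤ ∑ a ∈ U, z a) ∧
    (∀ a, 0 ≤ z a ∧ z a ≤ 1) ∧
    (∀ a, ∃ k : ℤ, z a = k)}

open Classical in
/-- `O(z)`: the set of terms `a` with `z_a = 1`. -/
noncomputable def termsOfPoint {d : ℕ} (z : termsLT n d → ℝ) : Finset (Fin n →₀ ℕ) :=
  (Finset.univ.filter fun a => z a = 1).map (Function.Embedding.subtype _)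

end Alg

end BorderBasis

/-! The algorithm is correct because of the following facts about a degree-compatible ordering.

`LStabSpan(F, d)` computes a basis `M` with distinct leading terms of the *stable span*: the least
space that contains `F` and every polynomial of degree `≤ d` in its neighbourhood extension
(`StabInv`). The elimination terminates because the leading term of the polynomial in work drops
(`gaussMeasure`), the loop because the polynomials appended are linearly independent
(`StabBasis.acc_extend`).

The heart is Mourrain's criterion `mem_of_isStable`: if all terms of degree `d` are leading terms
of the stable span `U`, then every polynomial of degree `≤ d` has a normal form of degree `< d`
modulo `U`, "multiply by `x_j` and reduce" gives commuting endomorphisms of the quotient by `U`,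
because `U` is stable, and hence a module over the polynomial ring in which the class of `1` is
annihilated by the ideal `I`, while a polynomial of degree `≤ d` sends it to its own class. So
`U = I ∩ K[X]_{≤ d}` (`stableSpan_eq`), and comparing dimensions shows that the adjusted `d` is the
colength `δ` of `I`. The hypothesis of the criterion holds for all large `d`
(`exists_forall_leadingTerms_stableSpan`), which ends the main loop.

The terms that are not leading terms of `I` form an order ideal with `δ` elements, so they have
degree `< δ`. Therefore the elements of degree `≤ δ` generate `I` (`ideal_span_eq`), and some order
ideal is admissible, so that the choice is always possible. An order ideal `O` is admissible iff
`⟨O⟩` is a complement of `I` (`mem_admissible_iff`). Among the order ideals in `L` of size `δ`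
these are the ones for which the columns outside `O` of a basis of `I ∩ ⟨L⟩` are linearly
independent; this is the rank condition of the polytope for `U = L \ O`, and it implies the
condition for all `U` (`mem_admissible_iff_exists_point`).

Finally, no row of the reduced row echelon form has its head in `O`, since it would lie in
`I ∩ ⟨O⟩ = 0`. Hence an element `b - r` of the border basis, a combination of rows whose
coefficients can be read off at the heads, is itself a row (`filter_head_eq_borderBasis`). The back
substitution terminates since the supports, read as binary numbers, decrease. -/

namespace BorderBasis

open MvPolynomial

section Echelon

/-! ### Heads and echelon form -/

variable {K : Type*} [Field K] {n : ℕ} {α : Type*} [LinearOrder α]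

/-- `hd` picks from every nonzero polynomial with terms in `D` the term that is the largest with
respect to the ranking `ρ` of the terms in `D`. This covers both the leading terms with respect to a
term ordering and the heads with respect to an arrangement of columns. -/
structure IsHead (K : Type*) [Field K] {n : ℕ} {α : Type*} [LinearOrder α]
    (D : Set (Fin n →₀ ℕ)) (hd : MvPolynomial (Fin n) K → (Fin n →₀ ℕ))
    (ρ : (Fin n →₀ ℕ) → α) : Prop where
  injOn : Set.InjOn ρ D
  mem_support : ∀ f ∈ restrictSupport K D, f ≠ 0 → hd f ∈ f.support
  le_head : ∀ f ∈ restrictSupport K D, ∀ t ∈ f.support, ρ t ≤ ρ (hd f)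

/-- The polynomials in `B` are supported on `D`, monic, and have distinct heads. -/
structure IsEchelon (D : Set (Fin n →₀ ℕ)) (hd : MvPolynomial (Fin n) K → (Fin n →₀ ℕ))
    (B : Finset (MvPolynomial (Fin n) K)) : Prop where
  mem : ∀ b ∈ B, b ∈ restrictSupport K D
  monic : ∀ b ∈ B, coeff (hd b) b = 1
  injOn : Set.InjOn hd (B : Set (MvPolynomial (Fin n) K))

variable {D : Set (Fin n →₀ ℕ)} {hd : MvPolynomial (Fin n) K → (Fin n →₀ ℕ)}
  {ρ : (Fin n →₀ ℕ) → α} {B : Finset (MvPolynomial (Fin n) K)}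

theorem IsEchelon.head_mem (hB : IsEchelon D hd B) {b : MvPolynomial (Fin n) K} (hb : b ∈ B) :
    hd b ∈ b.support := by
  rw [mem_support_iff, hB.monic b hb]; exact one_ne_zero

theorem IsEchelon.ne_zero (hB : IsEchelon D hd B) {b : MvPolynomial (Fin n) K} (hb : b ∈ B) :
    b ≠ 0 := by
  rintro rfl
  simpa using hB.head_mem hb

theorem IsEchelon.empty : IsEchelon D hd ∅ := ⟨by simp, by simp, by simp⟩

theorem IsEchelon.mono (hB : IsEchelon D hd B) {B' : Finset (MvPolynomial (Fin n) K)}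
    (h : B' ⊆ B) : IsEchelon D hd B' :=
  ⟨fun b hb => hB.mem b (h hb), fun b hb => hB.monic b (h hb),
    hB.injOn.mono (by exact_mod_cast h)⟩

theorem IsEchelon.span_le (hB : IsEchelon D hd B) :
    Submodule.span K (B : Set (MvPolynomial (Fin n) K)) ≤ restrictSupport K D :=
  Submodule.span_le.2 hB.mem

theorem IsHead.eq_head_of_le (h : IsHead K D hd ρ) {f : MvPolynomial (Fin n) K}
    (hf : f ∈ restrictSupport K D) {t : Fin n →₀ ℕ} (ht : t ∈ f.support)
    (hle : ∀ u ∈ f.support, ρ u ≤ ρ t) : hd f = t := by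
  have h0 : f ≠ 0 := by rintro rfl; simp at ht
  have hm := h.mem_support f hf h0
  exact h.injOn (hf hm) (hf ht) (le_antisymm (hle _ hm) (h.le_head f hf t ht))

/-- Subtracting a polynomial with smaller head keeps the head and its coefficient. -/
theorem IsHead.head_eq_of_sub (h : IsHead K D hd ρ) {f g : MvPolynomial (Fin n) K}
    (hf : f ∈ restrictSupport K D) (hg : g ∈ restrictSupport K D) (hf0 : f ≠ 0)
    (hlt : ρ (hd g) < ρ (hd f)) (c : K) :
    hd (f - C c * g) = hd f ∧ coeff (hd f) (f - C c * g) = coeff (hd f) f := by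
  have h0 : coeff (hd f) g = 0 := by
    by_contra h0
    exact absurd (h.le_head g hg _ (mem_support_iff.2 h0)) (not_le.2 hlt)
  have hc : coeff (hd f) (f - C c * g) = coeff (hd f) f := by
    rw [coeff_sub, coeff_C_mul, h0, mul_zero, sub_zero]
  have hmem : f - C c * g ∈ restrictSupport K D := by
    rw [C_mul']; exact Submodule.sub_mem _ hf (Submodule.smul_mem _ _ hg)
  refine ⟨h.eq_head_of_le hmem ?_ ?_, hc⟩
  · rw [mem_support_iff, hc, ← mem_support_iff]; exact h.mem_support f hf hf0
  · intro u hu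
    by_cases hfu : u ∈ f.support
    · exact h.le_head f hf u hfu
    · have : u ∈ g.support := by
        rw [mem_support_iff] at hu hfu ⊢
        intro hgu
        rw [coeff_sub, coeff_C_mul, hgu, not_not.1 hfu] at hu
        simp at hu
      exact (h.le_head g hg u this).trans hlt.le

/-- In a combination of rows in echelon form nothing cancels at the largest head that occurs. -/
theorem IsEchelon.exists_head (h : IsHead K D hd ρ) (hB : IsEchelon D hd B)
    {c : MvPolynomial (Fin n) K → K} (hc : ∃ b ∈ B, c b ≠ 0) :
    ∑ b ∈ B, c b • b ≠ 0 ∧ ∃ b ∈ B, hd b = hd (∑ b ∈ B, c b • b) ∧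
      ∀ b' ∈ B, c b' ≠ 0 → ρ (hd b') ≤ ρ (hd b) := by
  classical
  set p := ∑ b ∈ B, c b • b with hp
  have hne : (B.filter fun b => c b ≠ 0).Nonempty := by
    obtain ⟨b, hb, hcb⟩ := hc
    exact ⟨b, by simp [hb, hcb]⟩
  obtain ⟨m, hm, hmax⟩ := Finset.exists_max_image _ (fun b => ρ (hd b)) hne
  simp only [Finset.mem_filter] at hm hmax
  have hpD : p ∈ restrictSupport K D :=
    Submodule.sum_mem _ fun b hb => Submodule.smul_mem _ _ (hB.mem b hb)
  have hcoeff : coeff (hd m) p = c m := by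
    rw [hp, coeff_sum, Finset.sum_eq_single m]
    · rw [coeff_smul, hB.monic m hm.1, smul_eq_mul, mul_one]
    · intro b hb hbm
      by_cases hcb : c b = 0
      · simp [hcb]
      · rw [coeff_smul]
        by_contra hne
        have hmb : hd m ∈ b.support := mem_support_iff.2 fun h0 => hne (by rw [h0, smul_zero])
        have h1 := h.le_head b (hB.mem b hb) _ hmb
        have h2 := hmax b ⟨hb, hcb⟩
        exact hbm (hB.injOn hb hm.1 (h.injOn (hB.mem b hb (hB.head_mem hb))
          (hB.mem m hm.1 (hB.head_mem hm.1)) (le_antisymm h2 h1)))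
    · exact fun h => absurd hm.1 h
  have hmp : hd m ∈ p.support := by rw [mem_support_iff, hcoeff]; exact hm.2
  refine ⟨fun h0 => by simp [h0] at hmp, m, hm.1, ?_, fun b' hb' hcb' => hmax b' ⟨hb', hcb'⟩⟩
  refine (h.eq_head_of_le hpD hmp fun u hu => ?_).symm
  obtain ⟨b, hb, hub⟩ : ∃ b ∈ B, coeff u (c b • b) ≠ 0 := by
    by_contra! hcon
    rw [mem_support_iff, hp, coeff_sum, Finset.sum_eq_zero hcon] at hu
    exact hu rfl
  rw [coeff_smul, smul_eq_mul] at hub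
  exact (h.le_head b (hB.mem b hb) u (mem_support_iff.2 (right_ne_zero_of_mul hub))).trans
    (hmax b ⟨hb, left_ne_zero_of_mul hub⟩)

theorem exists_sum_of_mem_span {p : MvPolynomial (Fin n) K}
    (hp : p ∈ Submodule.span K (B : Set (MvPolynomial (Fin n) K))) :
    ∃ c : MvPolynomial (Fin n) K → K, ∑ b ∈ B, c b • b = p := by
  obtain ⟨c, -, h⟩ := Submodule.mem_span_finset.1 hp
  exact ⟨c, h⟩

theorem IsEchelon.exists_head_of_mem_span (h : IsHead K D hd ρ) (hB : IsEchelon D hd B)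
    {p : MvPolynomial (Fin n) K}
    (hp : p ∈ Submodule.span K (B : Set (MvPolynomial (Fin n) K))) (h0 : p ≠ 0) :
    ∃ b ∈ B, hd b = hd p := by
  obtain ⟨c, rfl⟩ := exists_sum_of_mem_span hp
  have : ∃ b ∈ B, c b ≠ 0 := by
    by_contra! hcon
    exact h0 (Finset.sum_eq_zero fun b hb => by rw [hcon b hb, zero_smul])
  obtain ⟨-, b, hb, hbe, -⟩ := hB.exists_head h this
  exact ⟨b, hb, hbe⟩

theorem IsEchelon.linearIndepOn (h : IsHead K D hd ρ) (hB : IsEchelon D hd B) :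
    LinearIndepOn K id (B : Set (MvPolynomial (Fin n) K)) := by
  rw [linearIndepOn_finset_iff]
  intro c hc b hb
  by_contra hcb
  exact (hB.exists_head h ⟨b, hb, hcb⟩).1 (by simpa using hc)

theorem IsEchelon.finrank_span (h : IsHead K D hd ρ) (hB : IsEchelon D hd B) :
    Module.finrank K (Submodule.span K (B : Set (MvPolynomial (Fin n) K))) = B.card :=
  finrank_span_finset_eq_card (hB.linearIndepOn h)

/-! ### Gaussian elimination -/

/-- The span of all polynomials present in a configuration of the elimination. -/
noncomputable def GaussState.spanned (s : GaussState K n) : Submodule K (MvPolynomial (Fin n) K) :=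
  Submodule.span K (s.V : Set (MvPolynomial (Fin n) K)) ⊔
    Submodule.span K (s.W : Set (MvPolynomial (Fin n) K)) ⊔
    Submodule.span K (s.H : Set (MvPolynomial (Fin n) K)) ⊔
    Submodule.span K {f | s.cur = some f}

open Classical in
/-- The invariant of `GaussEl(V, G)`. -/
structure GaussInv (D : Set (Fin n →₀ ℕ)) (hd : MvPolynomial (Fin n) K → (Fin n →₀ ℕ))
    (V G : Finset (MvPolynomial (Fin n) K)) (s : GaussState K n) : Prop where
  V_eq : s.V = V
  echelon : IsEchelon D hd (s.V ∪ s.W)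
  disjoint : Disjoint s.V s.W
  spanned_eq : s.spanned = Submodule.span K (V : Set (MvPolynomial (Fin n) K)) ⊔
    Submodule.span K (G : Set (MvPolynomial (Fin n) K))
  spanned_le : s.spanned ≤ restrictSupport K D

theorem GaussState.mem_spanned_cur {s : GaussState K n} {f : MvPolynomial (Fin n) K}
    (h : s.cur = some f) : f ∈ s.spanned :=
  Submodule.mem_sup_right (Submodule.subset_span h)

theorem GaussInv.start {V G : Finset (MvPolynomial (Fin n) K)} (hV : IsEchelon D hd V)
    (hG : ∀ g ∈ G, g ∈ restrictSupport K D) : GaussInv D hd V G (GaussState.start V G) := by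
  have he : (GaussState.start V G).spanned =
      Submodule.span K (V : Set (MvPolynomial (Fin n) K)) ⊔
      Submodule.span K (G : Set (MvPolynomial (Fin n) K)) := by
    simp [GaussState.spanned, GaussState.start]
  refine ⟨rfl, by simpa [GaussState.start] using hV, by simp [GaussState.start], he, ?_⟩
  rw [he]
  exact sup_le hV.span_le (Submodule.span_le.2 hG)

theorem GaussStep.spanned_eq {s s' : GaussState K n} (hs : GaussStep hd s s')
    (hcur : ∀ f, s.cur = some f → f ≠ 0 → coeff (hd f) f ≠ 0) :
    s'.spanned = s.spanned := by
  classical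
  have hnone : {f : MvPolynomial (Fin n) K | (none : Option (MvPolynomial (Fin n) K)) = some f} =
      ∅ := by ext; simp
  have hsome : ∀ g : MvPolynomial (Fin n) K,
      {f | some g = some f} = {g} := by intro g; ext; simp [eq_comm]
  cases hs with
  | pick V W H f hf =>
    simp only [GaussState.spanned, hnone, hsome, Submodule.span_empty, sup_bot_eq]
    conv_rhs => rw [← Finset.insert_erase hf, Finset.coe_insert, Submodule.span_insert]
    rw [sup_assoc _ (Submodule.span K (↑(H.erase f) : Set (MvPolynomial (Fin n) K))),
      sup_comm (Submodule.span K (↑(H.erase f) : Set (MvPolynomial (Fin n) K)))]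
  | reduce V W H f v hf hv hfv =>
    simp only [GaussState.spanned, hsome]
    have hv' : v ∈ Submodule.span K (V : Set (MvPolynomial (Fin n) K)) ⊔
        Submodule.span K (W : Set (MvPolynomial (Fin n) K)) ⊔
        Submodule.span K (H : Set (MvPolynomial (Fin n) K)) := by
      refine Submodule.mem_sup_left ?_
      rw [← Submodule.span_union, ← Finset.coe_union]
      exact Submodule.subset_span hv
    rw [C_mul']
    apply le_antisymm
    · refine sup_le le_sup_left ?_
      rw [Submodule.span_singleton_le_iff_mem]
      exact Submodule.sub_mem _ (Submodule.mem_sup_right (Submodule.mem_span_singleton_self f))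
        (Submodule.smul_mem _ _ (Submodule.mem_sup_left hv'))
    · refine sup_le le_sup_left ?_
      rw [Submodule.span_singleton_le_iff_mem]
      have := Submodule.add_mem _
        (Submodule.mem_sup_right (S := Submodule.span K (V : Set (MvPolynomial (Fin n) K)) ⊔
        Submodule.span K (W : Set (MvPolynomial (Fin n) K)) ⊔
        Submodule.span K (H : Set (MvPolynomial (Fin n) K)))
          (Submodule.mem_span_singleton_self (R := K) (f - coeff (hd f) f • v)))
        (Submodule.smul_mem _ (coeff (hd f) f) (Submodule.mem_sup_left hv'))
      rwa [sub_add_cancel] at this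
  | append V W H f hf hv =>
    simp only [GaussState.spanned, hnone, hsome, Submodule.span_empty, sup_bot_eq,
      Finset.coe_insert, Submodule.span_insert]
    rw [C_mul', Submodule.span_singleton_smul_eq (IsUnit.mk0 _ (inv_ne_zero (hcur f rfl hf)))]
    ac_rfl
  | drop V W H =>
    simp [GaussState.spanned]

theorem IsHead.head_smul (h : IsHead K D hd ρ) {f : MvPolynomial (Fin n) K}
    (hf : f ∈ restrictSupport K D) {c : K} (hc : c ≠ 0) : hd (c • f) = hd f := by
  by_cases h0 : f = 0
  · rw [h0, smul_zero]
  have hsupp : ∀ t, t ∈ (c • f).support ↔ t ∈ f.support := by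
    intro t; simp [mem_support_iff, hc]
  refine h.eq_head_of_le (Submodule.smul_mem _ _ hf) ?_ ?_
  · rw [hsupp]; exact h.mem_support f hf h0
  · intro u hu
    exact h.le_head f hf u ((hsupp u).1 hu)

/-- Cancelling the head makes it smaller, unless the result is zero. -/
theorem IsHead.head_cancel_lt (h : IsHead K D hd ρ) {f v : MvPolynomial (Fin n) K}
    (hf : f ∈ restrictSupport K D) (hv : v ∈ restrictSupport K D) (hfv : hd f = hd v)
    (hm : coeff (hd v) v = 1) (h0 : f - C (coeff (hd f) f) * v ≠ 0) :
    ρ (hd (f - C (coeff (hd f) f) * v)) < ρ (hd f) := by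
  set g := f - C (coeff (hd f) f) * v with hg
  have hgD : g ∈ restrictSupport K D := by
    rw [hg, C_mul']; exact Submodule.sub_mem _ hf (Submodule.smul_mem _ _ hv)
  have hmem := h.mem_support g hgD h0
  have hz : coeff (hd f) g = 0 := by
    rw [hg, coeff_sub, coeff_C_mul]
    nth_rewrite 3 [hfv]
    rw [hm, mul_one, sub_self]
  have hle : ρ (hd g) ≤ ρ (hd f) := by
    by_cases hfs : hd g ∈ f.support
    · exact h.le_head f hf _ hfs
    · rw [hfv]
      refine h.le_head v hv _ ?_
      rw [mem_support_iff] at hmem hfs ⊢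
      intro hvs
      rw [hg, coeff_sub, coeff_C_mul, ← hg, hvs, not_not.1 hfs] at hmem
      simp at hmem
  refine lt_of_le_of_ne hle fun he => ?_
  have hfD : hd f ∈ D := by
    refine hf (h.mem_support f hf ?_)
    rintro rfl
    simp [hg] at h0
  rw [h.injOn (hgD hmem) hfD he, mem_support_iff] at hmem
  exact hmem hz

theorem GaussInv.coeff_ne_zero (h : IsHead K D hd ρ) {V G : Finset (MvPolynomial (Fin n) K)}
    {s : GaussState K n} (hs : GaussInv D hd V G s) (f : MvPolynomial (Fin n) K)
    (hf : s.cur = some f) (h0 : f ≠ 0) : coeff (hd f) f ≠ 0 :=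
  mem_support_iff.1 (h.mem_support f (hs.spanned_le (GaussState.mem_spanned_cur hf)) h0)

theorem GaussInv.step (h : IsHead K D hd ρ) {V G : Finset (MvPolynomial (Fin n) K)}
    {s s' : GaussState K n} (hs : GaussInv D hd V G s) (hstep : GaussStep hd s s') :
    GaussInv D hd V G s' := by
  classical
  have hcur := hs.coeff_ne_zero h
  have hsp := hstep.spanned_eq hcur
  suffices s'.V = s.V ∧ IsEchelon D hd (s'.V ∪ s'.W) ∧ Disjoint s'.V s'.W from
    ⟨this.1.trans hs.V_eq, this.2.1, this.2.2, hsp.trans hs.spanned_eq, hsp.le.trans hs.spanned_le⟩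
  cases hstep with
  | pick V W H f hf => exact ⟨rfl, hs.echelon, hs.disjoint⟩
  | reduce V W H f v hf hv hfv => exact ⟨rfl, hs.echelon, hs.disjoint⟩
  | drop V W H => exact ⟨rfl, hs.echelon, hs.disjoint⟩
  | append V W H f hf hv =>
    have hfD : f ∈ restrictSupport K D := hs.spanned_le (GaussState.mem_spanned_cur rfl)
    have hc := hcur f rfl hf
    have hhd : hd ((coeff (hd f) f)⁻¹ • f) = hd f := h.head_smul hfD (inv_ne_zero hc)
    rw [C_mul']
    refine ⟨rfl, ?_, ?_⟩
    · simp only [Finset.union_insert]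
      refine ⟨?_, ?_, ?_⟩
      · intro b hb
        rcases Finset.mem_insert.1 hb with rfl | hb
        · exact Submodule.smul_mem _ _ hfD
        · exact hs.echelon.mem b hb
      · intro b hb
        rcases Finset.mem_insert.1 hb with rfl | hb
        · rw [hhd, coeff_smul, smul_eq_mul, inv_mul_cancel₀ hc]
        · exact hs.echelon.monic b hb
      · intro a ha b hb hab
        rcases Finset.mem_insert.1 ha with rfl | ha <;> rcases Finset.mem_insert.1 hb with rfl | hb
        · rfl
        · exact absurd (hhd.symm.trans hab) (hv b hb)
        · exact absurd (hhd.symm.trans hab.symm) (hv a ha)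
        · exact hs.echelon.injOn ha hb hab
    · simp only [Finset.disjoint_insert_right]
      refine ⟨fun hmem => hv _ (Finset.mem_union_left _ hmem) hhd.symm, hs.disjoint⟩

theorem GaussInv.span_eq_of_returns {V G W : Finset (MvPolynomial (Fin n) K)}
    {s : GaussState K n} (hs : GaussInv D hd V G s) (hret : s.Returns W) :
    Submodule.span K (V : Set (MvPolynomial (Fin n) K)) ⊔
      Submodule.span K (W : Set (MvPolynomial (Fin n) K)) =
    Submodule.span K (V : Set (MvPolynomial (Fin n) K)) ⊔
      Submodule.span K (G : Set (MvPolynomial (Fin n) K)) := by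
  obtain ⟨hH, hc, hW⟩ := hret
  rw [← hs.spanned_eq, GaussState.spanned, hs.V_eq, hH, hc, hW]
  simp

/-- Runs that preserve `P` and decrease a well-founded measure on `P` are finite. -/
theorem acc_of_measure {S β : Type*} [LT β] [WellFoundedLT β] {r : S → S → Prop} {P : S → Prop}
    (m : S → β) (hstep : ∀ s s', P s → r s s' → P s' ∧ m s' < m s) {s : S} (hs : P s) :
    Acc (fun a b => r b a) s := by
  have key : ∀ (b : β) (s : S), P s → m s = b → Acc (fun a b => r b a) s := by
    intro b
    induction b using WellFoundedLT.induction with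
    | ind b ih =>
      rintro s hs rfl
      exact ⟨s, fun s' hs' => ih _ (hstep s s' hs hs').2 s' (hstep s s' hs hs').1 rfl⟩
  exact key _ s hs rfl

open Classical in
/-- A quantity that decreases in every step of the elimination. -/
noncomputable def gaussMeasure (hd : MvPolynomial (Fin n) K → (Fin n →₀ ℕ))
    (ρ : (Fin n →₀ ℕ) → α) (s : GaussState K n) : ℕ ×ₗ WithBot (WithBot α) :=
  toLex (s.H.card, match s.cur with
    | none => ⊥
    | some f => if f = 0 then ((⊥ : WithBot α) : WithBot (WithBot α))
        else ((ρ (hd f) : WithBot α) : WithBot (WithBot α)))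

theorem GaussInv.measure_lt (h : IsHead K D hd ρ) {V G : Finset (MvPolynomial (Fin n) K)}
    {s s' : GaussState K n} (hs : GaussInv D hd V G s) (hstep : GaussStep hd s s') :
    gaussMeasure hd ρ s' < gaussMeasure hd ρ s := by
  classical
  rw [Prod.Lex.lt_iff]
  cases hstep with
  | pick V W H f hf =>
    exact Or.inl (Finset.card_erase_lt_of_mem hf)
  | reduce V W H f v hf hv hfv =>
    refine Or.inr ⟨rfl, ?_⟩
    simp only [gaussMeasure, ofLex_toLex, if_neg hf]
    split_ifs with h0
    · exact WithBot.coe_lt_coe.2 (WithBot.bot_lt_coe _)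
    · exact WithBot.coe_lt_coe.2 (WithBot.coe_lt_coe.2 (h.head_cancel_lt
        (hs.spanned_le (GaussState.mem_spanned_cur rfl)) (hs.echelon.mem v hv) hfv
        (hs.echelon.monic v hv) h0))
  | append V W H f hf hv =>
    refine Or.inr ⟨rfl, ?_⟩
    simp only [gaussMeasure, ofLex_toLex, if_neg hf]
    exact WithBot.bot_lt_coe _
  | drop V W H =>
    refine Or.inr ⟨rfl, ?_⟩
    simp only [gaussMeasure, ofLex_toLex, if_true]
    exact WithBot.bot_lt_coe _

theorem GaussInv.acc [WellFoundedLT α] (h : IsHead K D hd ρ)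
    {V G : Finset (MvPolynomial (Fin n) K)} {s : GaussState K n} (hs : GaussInv D hd V G s) :
    Acc (fun a b => GaussStep hd b a) s :=
  acc_of_measure (gaussMeasure hd ρ)
    (fun _ _ hP hst => ⟨GaussInv.step h hP hst, GaussInv.measure_lt h hP hst⟩) hs

/-- The elimination only stops by returning a result. -/
theorem GaussState.exists_step_or_returns (hd : MvPolynomial (Fin n) K → (Fin n →₀ ℕ))
    (s : GaussState K n) : (∃ s', GaussStep hd s s') ∨ ∃ W, s.Returns W := by
  classical
  obtain ⟨V, W, H, cur⟩ := s
  cases cur with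
  | none =>
    rcases H.eq_empty_or_nonempty with rfl | ⟨f, hf⟩
    · exact Or.inr ⟨W, rfl, rfl, rfl⟩
    · exact Or.inl ⟨_, .pick V W H f hf⟩
  | some f =>
    left
    by_cases h0 : f = 0
    · subst h0; exact ⟨_, .drop V W H⟩
    · by_cases hv : ∃ v ∈ V ∪ W, hd f = hd v
      · obtain ⟨v, hv, hfv⟩ := hv
        exact ⟨_, .reduce V W H f v h0 hv hfv⟩
      · push Not at hv
        exact ⟨_, .append V W H f h0 hv⟩

end Echelon

section Algebra

variable {K : Type*} [Field K] {n : ℕ}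

/-! ### Polynomials of bounded degree -/

/-- The space of polynomials of degree `< d`. -/
noncomputable def degLT (K : Type*) [Field K] (n d : ℕ) : Submodule K (MvPolynomial (Fin n) K) :=
  restrictSupport K (termsLT n d : Set (Fin n →₀ ℕ))

theorem mem_degLT {d : ℕ} {p : MvPolynomial (Fin n) K} :
    p ∈ degLT K n d ↔ ∀ t ∈ p.support, t.degree < d := by
  rw [degLT, mem_restrictSupport_iff]
  exact ⟨fun h t ht => mem_termsLT.1 (h ht), fun h t ht => mem_termsLT.2 (h t ht)⟩

theorem degree_le_totalDegree {p : MvPolynomial (Fin n) K} {t : Fin n →₀ ℕ}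
    (ht : t ∈ p.support) : t.degree ≤ p.totalDegree :=
  le_totalDegree ht

theorem mem_degLT_succ {d : ℕ} {p : MvPolynomial (Fin n) K} :
    p ∈ degLT K n (d + 1) ↔ p.totalDegree ≤ d := by
  rw [mem_degLT]
  refine ⟨fun h => Finset.sup_le fun t ht => ?_, fun h t ht => ?_⟩
  · exact Nat.lt_succ_iff.1 (h t ht)
  · exact Nat.lt_succ_iff.2 ((degree_le_totalDegree ht).trans h)

theorem mem_degLT_of_totalDegree_lt {d : ℕ} {p : MvPolynomial (Fin n) K}
    (h : p.totalDegree < d) : p ∈ degLT K n d :=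
  mem_degLT.2 fun _ ht => (degree_le_totalDegree ht).trans_lt h

theorem totalDegree_lt_of_mem_degLT {d : ℕ} {p : MvPolynomial (Fin n) K}
    (h : p ∈ degLT K n d) (h0 : p ≠ 0) : p.totalDegree < d := by
  obtain ⟨t, ht⟩ := support_nonempty.2 h0
  obtain ⟨e, rfl⟩ := Nat.exists_eq_succ_of_ne_zero (Nat.ne_zero_of_lt (mem_degLT.1 h t ht))
  exact Nat.lt_succ_of_le (mem_degLT_succ.1 h)

theorem degLT_mono {d e : ℕ} (h : d ≤ e) : degLT K n d ≤ degLT K n e :=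
  fun _ hp => mem_degLT.2 fun t ht => (mem_degLT.1 hp t ht).trans_le h

theorem mul_X_mem_degLT {d : ℕ} {p : MvPolynomial (Fin n) K} (hp : p ∈ degLT K n d) (j : Fin n) :
    p * X j ∈ degLT K n (d + 1) := by
  by_cases h0 : p = 0
  · simp [h0]
  · have := totalDegree_lt_of_mem_degLT hp h0
    rw [mem_degLT_succ]
    have := totalDegree_mul p (X j)
    rw [totalDegree_X] at this
    omega

theorem monomial_mem_degLT {d : ℕ} {t : Fin n →₀ ℕ} (h : t.degree < d) (c : K) :
    monomial t c ∈ degLT K n d :=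
  (monomial_mem_restrictSupport K).2 (Or.inl (mem_termsLT.2 h))

theorem finrank_restrictSupport (s : Finset (Fin n →₀ ℕ)) :
    Module.finrank K (restrictSupport K (s : Set (Fin n →₀ ℕ))) = s.card := by
  rw [Module.finrank_eq_card_basis (basisRestrictSupport K (s : Set (Fin n →₀ ℕ)))]
  simp

instance finite_restrictSupport (s : Finset (Fin n →₀ ℕ)) :
    Module.Finite K (restrictSupport K (s : Set (Fin n →₀ ℕ))) :=
  Module.Finite.of_basis (basisRestrictSupport K (s : Set (Fin n →₀ ℕ)))

instance finite_degLT (d : ℕ) : Module.Finite K (degLT K n d) :=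
  finite_restrictSupport _

theorem mem_of_monomial_mem {s : Set (Fin n →₀ ℕ)} {U : Submodule K (MvPolynomial (Fin n) K)}
    (h : ∀ t ∈ s, monomial t (1 : K) ∈ U) : restrictSupport K s ≤ U := by
  rw [restrictSupport_eq_span, Submodule.span_le]
  rintro _ ⟨t, ht, rfl⟩
  exact h t ht

theorem monomial_succ (t : Fin n →₀ ℕ) (j : Fin n) :
    (monomial (t + Finsupp.single j 1) (1 : K)) = monomial t 1 * X j := by
  rw [X, monomial_mul, one_mul]

theorem degree_add_single (t : Fin n →₀ ℕ) (j : Fin n) :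
    (t + Finsupp.single j 1).degree = t.degree + 1 := by
  rw [map_add, Finsupp.degree_single]

/-! ### Leading terms -/

/-- The leading terms of the nonzero elements of a space of polynomials. -/
def leadingTerms (σ : MonomialOrder (Fin n)) (U : Submodule K (MvPolynomial (Fin n) K)) :
    Set (Fin n →₀ ℕ) :=
  {t | ∃ g ∈ U, g ≠ 0 ∧ σ.degree g = t}

theorem leadingTerms_mono (σ : MonomialOrder (Fin n))
    {U U' : Submodule K (MvPolynomial (Fin n) K)} (h : U ≤ U') :
    leadingTerms σ U ⊆ leadingTerms σ U' :=
  fun _ ⟨g, hg, h1⟩ => ⟨g, h hg, h1⟩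

/-- `σ` is degree-compatible. -/
def DegCompat (σ : MonomialOrder (Fin n)) : Prop :=
  ∀ a b : Fin n →₀ ℕ, a.degree < b.degree → σ.toSyn a < σ.toSyn b

variable {σ : MonomialOrder (Fin n)}

theorem DegCompat.degree_le (hσ : DegCompat σ) {a b : Fin n →₀ ℕ} (h : σ.toSyn a ≤ σ.toSyn b) :
    a.degree ≤ b.degree :=
  not_lt.1 fun hlt => not_lt.2 h (hσ b a hlt)

theorem DegCompat.degree_degree (hσ : DegCompat σ) (p : MvPolynomial (Fin n) K) :
    (σ.degree p).degree = p.totalDegree := by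
  by_cases h0 : p = 0
  · simp [h0]
  · refine le_antisymm (degree_le_totalDegree (σ.degree_mem_support h0)) ?_
    exact Finset.sup_le fun t ht => hσ.degree_le (σ.le_degree ht)

theorem isHead_degree (σ : MonomialOrder (Fin n)) :
    IsHead K Set.univ (σ.degree (R := K)) σ.toSyn :=
  ⟨σ.toSyn.injective.injOn, fun _ _ h0 => σ.degree_mem_support h0,
    fun _ _ _ ht => σ.le_degree ht⟩

theorem mem_leadingTerms_add {I : Ideal (MvPolynomial (Fin n) K)} {t : Fin n →₀ ℕ}
    (ht : t ∈ leadingTerms σ (I.restrictScalars K)) (u : Fin n →₀ ℕ) :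
    u + t ∈ leadingTerms σ (I.restrictScalars K) := by
  classical
  obtain ⟨g, hg, h0, rfl⟩ := ht
  have hm : (monomial u (1 : K)) ≠ 0 := by simp [monomial_eq_zero]
  refine ⟨monomial u 1 * g, I.mul_mem_left _ hg, mul_ne_zero hm h0, ?_⟩
  rw [σ.degree_mul hm h0, σ.degree_monomial, if_neg one_ne_zero]

/-- Division: modulo an ideal every polynomial is supported outside the leading terms. -/
theorem exists_sub_mem (σ : MonomialOrder (Fin n)) (I : Ideal (MvPolynomial (Fin n) K))
    (p : MvPolynomial (Fin n) K) :
    ∃ r ∈ restrictSupport K (leadingTerms σ (I.restrictScalars K))ᶜ, p - r ∈ I := by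
  obtain ⟨g, r, hp, -, hr⟩ := σ.div_set (B := {b | b ∈ I ∧ b ≠ 0})
    (fun b hb => IsUnit.mk0 _ (σ.leadingCoeff_ne_zero_iff.2 hb.2)) p
  refine ⟨r, ?_, ?_⟩
  · rw [mem_restrictSupport_iff]
    rintro c hc ⟨b, hb, hb0, rfl⟩
    exact hr _ hc b ⟨hb, hb0⟩ le_rfl
  · rw [hp, add_sub_cancel_right, Finsupp.linearCombination_apply]
    exact Ideal.sum_mem _ fun b _ => I.mul_mem_left _ b.2.1

theorem isCompl_leadingTerms (σ : MonomialOrder (Fin n)) (I : Ideal (MvPolynomial (Fin n) K)) :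
    IsCompl (I.restrictScalars K)
      (restrictSupport K (leadingTerms σ (I.restrictScalars K))ᶜ) := by
  refine ⟨Submodule.disjoint_def.2 fun p hp hp' => ?_, codisjoint_iff.2 (eq_top_iff.2 ?_)⟩
  · by_contra h0
    exact hp' (σ.degree_mem_support h0) ⟨p, hp, h0, rfl⟩
  · intro p _
    obtain ⟨r, hr, hpr⟩ := exists_sub_mem σ I p
    rw [← sub_add_cancel p r]
    exact Submodule.add_mem_sup hpr hr

theorem finrank_quotient_of_isCompl {I : Ideal (MvPolynomial (Fin n) K)}
    {W : Submodule K (MvPolynomial (Fin n) K)} (h : IsCompl (I.restrictScalars K) W) :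
    Module.finrank K (MvPolynomial (Fin n) K ⧸ I) = Module.finrank K W :=
  ((Submodule.Quotient.restrictScalarsEquiv K I).symm.trans
    (Submodule.quotientEquivOfIsCompl _ _ h)).finrank_eq

/-! ### Order ideals with a border basis -/

/-- A term of degree `k` has divisors of all degrees `0, …, k`, so it needs an order ideal with more
than `k` elements. -/
theorem IsOrderIdeal.degree_lt_card {O : Finset (Fin n →₀ ℕ)} (hO : IsOrderIdeal O)
    {t : Fin n →₀ ℕ} (ht : t ∈ O) : t.degree < O.card := by
  have hsub : Finset.range (t.degree + 1) ⊆ O.image Finsupp.degree := by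
    intro k hk
    obtain ⟨t', hle, hk'⟩ := Finsupp.exists_le_degree_eq t k
      (Nat.lt_succ_iff.1 (Finset.mem_range.1 hk))
    exact Finset.mem_image.2 ⟨t', hO t ht t' hle, hk'⟩
  have := (Finset.card_le_card hsub).trans Finset.card_image_le
  rw [Finset.card_range] at this
  exact this

theorem notMem_of_mem_border {O : Finset (Fin n →₀ ℕ)} {b : Fin n →₀ ℕ} (hb : b ∈ border O) :
    b ∉ O := by
  unfold border at hb
  split_ifs at hb with h
  · simp [h]
  · exact (Finset.mem_sdiff.1 hb).2

theorem add_single_mem {O : Finset (Fin n →₀ ℕ)} {t : Fin n →₀ ℕ} (ht : t ∈ O) (j : Fin n) :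
    t + Finsupp.single j 1 ∈ O ∨ t + Finsupp.single j 1 ∈ border O := by
  by_cases h : t + Finsupp.single j 1 ∈ O
  · exact Or.inl h
  · right
    rw [border, if_neg (Finset.ne_empty_of_mem ht), Finset.mem_sdiff, Finset.mem_biUnion]
    exact ⟨⟨t, ht, Finset.mem_image_of_mem _ (Finset.mem_univ j)⟩, h⟩

theorem degree_le_of_mem_border {O : Finset (Fin n →₀ ℕ)} (hO : IsOrderIdeal O)
    {b : Fin n →₀ ℕ} (hb : b ∈ border O) : b.degree ≤ O.card := by
  unfold border at hb
  split_ifs at hb with h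
  · simp_all
  · obtain ⟨t, ht, hb⟩ := Finset.mem_biUnion.1 (Finset.mem_sdiff.1 hb).1
    obtain ⟨j, -, rfl⟩ := Finset.mem_image.1 hb
    rw [degree_add_single]
    exact hO.degree_lt_card ht

variable {I : Ideal (MvPolynomial (Fin n) K)} {O : Finset (Fin n →₀ ℕ)}

theorem sum_monomial_mem_restrictSupport (α : (Fin n →₀ ℕ) → K) :
    ∑ t ∈ O, monomial t (α t) ∈ restrictSupport K (O : Set (Fin n →₀ ℕ)) :=
  Submodule.sum_mem _ fun _ ht => (monomial_mem_restrictSupport K).2 (Or.inl ht)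

theorem sum_monomial_coeff {p : MvPolynomial (Fin n) K}
    (hp : p ∈ restrictSupport K (O : Set (Fin n →₀ ℕ))) :
    ∑ t ∈ O, monomial t (coeff t p) = p := by
  conv_rhs => rw [← support_sum_monomial_coeff p]
  refine (Finset.sum_subset (by exact_mod_cast hp) fun t _ ht => ?_).symm
  rw [notMem_support_iff.1 ht, map_zero]

theorem IsBorderBasis.isCompl_restrictSupport {G : Finset (MvPolynomial (Fin n) K)}
    (hG : IsBorderBasis I O G) :
    IsCompl (I.restrictScalars K) (restrictSupport K (O : Set (Fin n →₀ ℕ))) := by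
  rw [restrictSupport_eq_span]
  exact hG.isCompl

theorem eq_zero_of_isCompl
    (h : IsCompl (I.restrictScalars K) (restrictSupport K (O : Set (Fin n →₀ ℕ))))
    {p : MvPolynomial (Fin n) K} (hp : p ∈ I)
    (hpO : p ∈ restrictSupport K (O : Set (Fin n →₀ ℕ))) : p = 0 :=
  Submodule.disjoint_def.1 h.disjoint p hp hpO

/-- The elements of a border basis are the elements of the ideal of the form `b - r` with `b` in
the border and `r` supported on the order ideal. -/
theorem IsBorderBasis.mem_iff {G : Finset (MvPolynomial (Fin n) K)}
    (hG : IsBorderBasis I O G) {g : MvPolynomial (Fin n) K} :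
    g ∈ G ↔ g ∈ I ∧ ∃ b ∈ border O,
      monomial b 1 - g ∈ restrictSupport K (O : Set (Fin n →₀ ℕ)) := by
  classical
  obtain ⟨α, hα⟩ := hG.form
  have hGI : ∀ g ∈ G, g ∈ I := fun g hg => by
    rw [← hG.span_eq]; exact Ideal.subset_span hg
  constructor
  · intro hg
    refine ⟨hGI g hg, ?_⟩
    rw [hα] at hg
    obtain ⟨b, hb, rfl⟩ := Finset.mem_image.1 hg
    refine ⟨b, hb, ?_⟩
    rw [sub_sub_cancel]
    exact sum_monomial_mem_restrictSupport _
  · rintro ⟨hgI, b, hb, hgb⟩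
    have hg' : monomial b 1 - ∑ t ∈ O, monomial t (α t b) ∈ G := by
      rw [hα]; exact Finset.mem_image_of_mem _ hb
    have : g - (monomial b 1 - ∑ t ∈ O, monomial t (α t b)) = 0 := by
      refine eq_zero_of_isCompl hG.isCompl_restrictSupport
        (Ideal.sub_mem _ hgI (hGI _ hg')) ?_
      have h2 := Submodule.sub_mem _
        (sum_monomial_mem_restrictSupport (O := O) fun t => α t b) hgb
      convert h2 using 1
      ring
    rw [sub_eq_zero.1 this]
    exact hg'

theorem IsBorderBasis.unique {G G' : Finset (MvPolynomial (Fin n) K)}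
    (hG : IsBorderBasis I O G) (hG' : IsBorderBasis I O G') : G' = G := by
  ext g
  rw [hG.mem_iff, hG'.mem_iff]

/-- If `⟨O⟩` is a complement of `I`, the polynomials `b - r` with `b` in the border and `r ∈ ⟨O⟩`
the normal form of `b` are a border basis: the ideal they generate and `⟨O⟩` span a space that
contains `1` and is closed under multiplication by the variables. -/
theorem exists_isBorderBasis (hO : IsOrderIdeal O)
    (h : IsCompl (I.restrictScalars K) (restrictSupport K (O : Set (Fin n →₀ ℕ)))) :
    ∃ G, IsBorderBasis I O G := by
  classical
  have hex : ∀ b : Fin n →₀ ℕ, ∃ r ∈ restrictSupport K (O : Set (Fin n →₀ ℕ)),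
      monomial b 1 - r ∈ I := by
    intro b
    have hb : (monomial b (1 : K)) ∈ I.restrictScalars K ⊔
        restrictSupport K (O : Set (Fin n →₀ ℕ)) := by
      rw [h.sup_eq_top]; trivial
    obtain ⟨p, hp, r, hr, hpr⟩ := Submodule.mem_sup.1 hb
    exact ⟨r, hr, by rw [← hpr, add_sub_cancel_right]; exact hp⟩
  choose r hr hrI using hex
  set G := (border O).image fun b => monomial b (1 : K) - r b with hG
  set J := Ideal.span (G : Set (MvPolynomial (Fin n) K)) with hJ
  have hJI : J ≤ I := by
    rw [hJ, Ideal.span_le]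
    intro g hg
    obtain ⟨b, -, rfl⟩ := Finset.mem_image.1 hg
    exact hrI b
  set W := J.restrictScalars K ⊔ restrictSupport K (O : Set (Fin n →₀ ℕ)) with hW
  have hOW : ∀ t ∈ O, monomial t (1 : K) ∈ W := fun t ht =>
    Submodule.mem_sup_right ((monomial_mem_restrictSupport K).2 (Or.inl ht))
  have hbW : ∀ b ∈ border O, monomial b (1 : K) ∈ W := by
    intro b hb
    rw [← sub_add_cancel (monomial b (1 : K)) (r b)]
    exact Submodule.add_mem_sup (Ideal.subset_span (Finset.mem_image_of_mem _ hb)) (hr b)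
  have hmul : ∀ j : Fin n, ∀ p ∈ W, p * X j ∈ W := by
    intro j p hp
    obtain ⟨q, hq, s, hs, rfl⟩ := Submodule.mem_sup.1 hp
    rw [add_mul]
    refine Submodule.add_mem _ (Submodule.mem_sup_left (J.mul_mem_right _ hq)) ?_
    have : restrictSupport K (O : Set (Fin n →₀ ℕ)) ≤
        W.comap (LinearMap.mulRight K (X j)) := by
      refine mem_of_monomial_mem fun t ht => ?_
      rw [Submodule.mem_comap, LinearMap.mulRight_apply, ← monomial_succ]
      rcases add_single_mem ht j with h1 | h1
      · exact hOW _ h1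
      · exact hbW _ h1
    exact this hs
  have hone : (1 : MvPolynomial (Fin n) K) ∈ W := by
    change monomial 0 1 ∈ W
    rcases O.eq_empty_or_nonempty with h0 | ⟨t, ht⟩
    · exact hbW 0 (by simp [border, h0])
    · exact hOW 0 (hO t ht 0 (zero_le))
  have hall : ∀ p : MvPolynomial (Fin n) K, p ∈ W := by
    intro p
    induction p using MvPolynomial.induction_on with
    | C a => rw [← mul_one (C a), C_mul']; exact Submodule.smul_mem _ _ hone
    | add p q hp hq => exact Submodule.add_mem _ hp hq
    | mul_X p j hp => exact hmul j p hp
  refine ⟨G, hO, ⟨fun t b => coeff t (r b), ?_⟩, ?_, ?_⟩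
  · rw [hG]
    refine Finset.image_congr fun b _ => ?_
    change monomial b 1 - r b = _
    rw [sum_monomial_coeff (hr b)]
  · refine le_antisymm hJI fun p hp => ?_
    obtain ⟨q, hq, s, hs, hqs⟩ := Submodule.mem_sup.1 (hall p)
    have : s ∈ I := by
      rw [← add_sub_cancel_left q s, hqs]; exact I.sub_mem hp (hJI hq)
    rw [eq_zero_of_isCompl h this hs, add_zero] at hqs
    rw [← hqs]; exact hq
  · rw [restrictSupport_eq_span] at h
    exact h

theorem mem_admissible_iff :
    O ∈ admissible I ↔ IsOrderIdeal O ∧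
      IsCompl (I.restrictScalars K) (restrictSupport K (O : Set (Fin n →₀ ℕ))) :=
  ⟨fun ⟨_, hG⟩ => ⟨hG.isOrderIdeal, hG.isCompl_restrictSupport⟩,
    fun h => exists_isBorderBasis h.1 h.2⟩

theorem card_of_isCompl
    (h : IsCompl (I.restrictScalars K) (restrictSupport K (O : Set (Fin n →₀ ℕ)))) :
    O.card = Module.finrank K (MvPolynomial (Fin n) K ⧸ I) := by
  rw [finrank_quotient_of_isCompl h, finrank_restrictSupport]

/-- The terms that are not leading terms form an admissible order ideal. -/
theorem exists_admissible (σ : MonomialOrder (Fin n))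
    (hfin : FiniteDimensional K (MvPolynomial (Fin n) K ⧸ I)) :
    ∃ O ∈ admissible I, (O : Set (Fin n →₀ ℕ)) = (leadingTerms σ (I.restrictScalars K))ᶜ := by
  have hc := isCompl_leadingTerms σ I
  have : Module.Finite K (restrictSupport K (leadingTerms σ (I.restrictScalars K))ᶜ) :=
    Module.Finite.equiv ((Submodule.Quotient.restrictScalarsEquiv K I).symm.trans
      (Submodule.quotientEquivOfIsCompl _ _ hc))
  have hf : Finite ↑(leadingTerms σ (I.restrictScalars K))ᶜ :=
    Module.Finite.finite_basis (basisRestrictSupport K _)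
  obtain ⟨O, hO⟩ := (Set.toFinite (leadingTerms σ (I.restrictScalars K))ᶜ).exists_finset_coe
  refine ⟨O, mem_admissible_iff.2 ⟨fun t ht t' hle => ?_, by rw [hO]; exact hc⟩, hO⟩
  rw [← Finset.mem_coe, hO] at ht ⊢
  intro ht'
  apply ht
  rw [← tsub_add_cancel_of_le hle]
  exact mem_leadingTerms_add ht' _

end Algebra

section StableSpan

variable {K : Type*} [Field K] {n : ℕ}

/-! ### The stable span -/

/-- The space `U + x_1 U + ⋯ + x_n U`. -/
noncomputable def extension (U : Submodule K (MvPolynomial (Fin n) K)) :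
    Submodule K (MvPolynomial (Fin n) K) :=
  U ⊔ ⨆ j : Fin n, U.map (LinearMap.mulRight K (X j))

theorem le_extension (U : Submodule K (MvPolynomial (Fin n) K)) : U ≤ extension U := le_sup_left

theorem mul_X_mem_extension {U : Submodule K (MvPolynomial (Fin n) K)}
    {p : MvPolynomial (Fin n) K} (hp : p ∈ U) (j : Fin n) : p * X j ∈ extension U :=
  Submodule.mem_sup_right (Submodule.mem_iSup_of_mem j ⟨p, hp, rfl⟩)

theorem extension_le {U U' : Submodule K (MvPolynomial (Fin n) K)} (h : U ≤ U')
    (hX : ∀ p ∈ U, ∀ j, p * X j ∈ U') : extension U ≤ U' := by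
  refine sup_le h (iSup_le fun j => ?_)
  rintro _ ⟨p, hp, rfl⟩
  exact hX p hp j

theorem extension_mono {U U' : Submodule K (MvPolynomial (Fin n) K)} (h : U ≤ U') :
    extension U ≤ extension U' :=
  extension_le (h.trans (le_extension U')) fun _ hp j => mul_X_mem_extension (h hp) j

theorem span_neighborhood (V : Finset (MvPolynomial (Fin n) K)) :
    Submodule.span K (neighborhood V : Set (MvPolynomial (Fin n) K)) =
      extension (Submodule.span K (V : Set (MvPolynomial (Fin n) K))) := by
  classical
  have hV : V ⊆ neighborhood V := by unfold neighborhood; exact Finset.subset_union_left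
  apply le_antisymm
  · rw [Submodule.span_le]
    intro p hp
    rcases Finset.mem_union.1 (show p ∈ _ ∪ _ from hp) with hp | hp
    · exact le_extension _ (Submodule.subset_span hp)
    · obtain ⟨j, -, hp⟩ := Finset.mem_biUnion.1 hp
      obtain ⟨w, hw, rfl⟩ := Finset.mem_image.1 hp
      exact mul_X_mem_extension (Submodule.subset_span hw) j
  · refine extension_le (Submodule.span_mono (by exact_mod_cast hV)) fun p hp j => ?_
    have : Submodule.span K (V : Set (MvPolynomial (Fin n) K)) ≤
        (Submodule.span K (neighborhood V : Set (MvPolynomial (Fin n) K))).comap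
          (LinearMap.mulRight K (X j)) := by
      rw [Submodule.span_le]
      intro w hw
      refine Submodule.subset_span ?_
      refine Finset.mem_coe.2 (Finset.mem_union_right _ ?_)
      exact Finset.mem_biUnion.2 ⟨j, Finset.mem_univ j, Finset.mem_image_of_mem _ hw⟩
    exact this hp

/-- A space of polynomials is stable in degree `≤ d` if it contains all elements of degree `≤ d` of
its extension. -/
def IsStable (d : ℕ) (U : Submodule K (MvPolynomial (Fin n) K)) : Prop :=
  ∀ p ∈ extension U, p.totalDegree ≤ d → p ∈ U

/-- The least space that contains `F` and is stable in degree `≤ d`. -/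
noncomputable def stableSpan (F : Finset (MvPolynomial (Fin n) K)) (d : ℕ) :
    Submodule K (MvPolynomial (Fin n) K) :=
  sInf {U | (F : Set (MvPolynomial (Fin n) K)) ⊆ U ∧ IsStable d U}

variable {F : Finset (MvPolynomial (Fin n) K)} {d : ℕ}

theorem stableSpan_le {U : Submodule K (MvPolynomial (Fin n) K)}
    (hF : (F : Set (MvPolynomial (Fin n) K)) ⊆ U) (hU : IsStable d U) : stableSpan F d ≤ U :=
  sInf_le ⟨hF, hU⟩

theorem subset_stableSpan (F : Finset (MvPolynomial (Fin n) K)) (d : ℕ) :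
    (F : Set (MvPolynomial (Fin n) K)) ⊆ stableSpan F d := by
  intro f hf
  rw [SetLike.mem_coe, stableSpan, Submodule.mem_sInf]
  exact fun U hU => hU.1 hf

theorem isStable_stableSpan (F : Finset (MvPolynomial (Fin n) K)) (d : ℕ) :
    IsStable d (stableSpan F d) := by
  intro p hp hd
  rw [stableSpan, Submodule.mem_sInf]
  exact fun U hU => hU.2 p (extension_mono (stableSpan_le hU.1 hU.2) hp) hd

theorem stableSpan_mono {e : ℕ} (h : d ≤ e) : stableSpan F d ≤ stableSpan F e :=
  stableSpan_le (subset_stableSpan F e) fun p hp hd =>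
    isStable_stableSpan F e p hp (hd.trans h)

theorem stableSpan_le_ideal {I : Ideal (MvPolynomial (Fin n) K)} (hF : ∀ f ∈ F, f ∈ I) :
    stableSpan F d ≤ I.restrictScalars K := by
  refine stableSpan_le hF fun p hp _ => ?_
  exact extension_le (U' := I.restrictScalars K) le_rfl
    (fun q hq j => I.mul_mem_right _ hq) hp

theorem stableSpan_le_degLT (hF : ∀ f ∈ F, f.totalDegree ≤ d) :
    stableSpan F d ≤ degLT K n (d + 1) :=
  stableSpan_le (fun f hf => mem_degLT_succ.2 (hF f hf)) fun _ _ h => mem_degLT_succ.2 h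

/-- Induction on terms by multiplication with one variable at a time. -/
theorem term_induction {P : (Fin n →₀ ℕ) → Prop} (h0 : P 0)
    (hs : ∀ t j, P t → P (t + Finsupp.single j 1)) (t : Fin n →₀ ℕ) : P t := by
  induction hk : t.degree generalizing t with
  | zero => rw [(Finsupp.degree_eq_zero_iff t).1 hk]; exact h0
  | succ k ih =>
    have hne : t ≠ 0 := by rintro rfl; simp at hk
    obtain ⟨j, hj⟩ := Finsupp.ne_iff.1 hne
    have hle : Finsupp.single j 1 ≤ t := by
      rw [Finsupp.single_le_iff]
      exact Nat.one_le_iff_ne_zero.2 hj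
    have he : t - Finsupp.single j 1 + Finsupp.single j 1 = t := tsub_add_cancel_of_le hle
    rw [← he]
    refine hs _ j (ih _ ?_)
    rw [← he, degree_add_single] at hk
    exact Nat.succ_injective hk

theorem totalDegree_monomial_mul {p : MvPolynomial (Fin n) K} (u : Fin n →₀ ℕ) :
    (monomial u (1 : K) * p).totalDegree ≤ u.degree + p.totalDegree := by
  refine (totalDegree_mul _ _).trans (Nat.add_le_add_right ?_ _)
  exact totalDegree_monomial_le u 1

theorem monomial_mul_mem_stableSpan {p : MvPolynomial (Fin n) K} (hp : p ∈ stableSpan F d)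
    (u : Fin n →₀ ℕ) (h : u.degree + p.totalDegree ≤ d) :
    monomial u 1 * p ∈ stableSpan F d := by
  induction u using term_induction with
  | h0 => simpa using hp
  | hs u j ih =>
    have hd : (monomial (u + Finsupp.single j 1) (1 : K) * p).totalDegree ≤ d :=
      (totalDegree_monomial_mul _).trans h
    rw [degree_add_single] at h
    rw [monomial_succ, mul_right_comm] at hd ⊢
    exact isStable_stableSpan F d _ (mul_X_mem_extension (ih (by omega)) j) hd

/-- The stable spans exhaust the ideal generated by `F`. -/
theorem exists_mem_stableSpan {p : MvPolynomial (Fin n) K}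
    (hp : p ∈ Ideal.span (F : Set (MvPolynomial (Fin n) K))) : ∃ d, p ∈ stableSpan F d := by
  induction hp using Submodule.span_induction with
  | mem f hf => exact ⟨0, subset_stableSpan F 0 hf⟩
  | zero => exact ⟨0, Submodule.zero_mem _⟩
  | add p q _ _ hp hq =>
    obtain ⟨d, hd⟩ := hp
    obtain ⟨e, he⟩ := hq
    exact ⟨max d e, Submodule.add_mem _ (stableSpan_mono (le_max_left d e) hd)
      (stableSpan_mono (le_max_right d e) he)⟩
  | smul r p _ hp =>
    obtain ⟨d, hd⟩ := hp
    refine ⟨max d (r.totalDegree + p.totalDegree), ?_⟩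
    rw [smul_eq_mul]
    conv in r * p => rw [r.as_sum]
    rw [Finset.sum_mul]
    refine Submodule.sum_mem _ fun t ht => ?_
    have : monomial t (coeff t r) * p = coeff t r • (monomial t 1 * p) := by
      rw [← smul_mul_assoc, smul_monomial, smul_eq_mul, mul_one]
    rw [this]
    refine Submodule.smul_mem _ _ (monomial_mul_mem_stableSpan
      (stableSpan_mono (le_max_left _ _) hd) t ?_)
    have := degree_le_totalDegree ht
    omega

/-! ### Top-covered stable spaces are truncated ideals -/

variable {σ : MonomialOrder (Fin n)}

/-- If the terms of degree `d` are leading terms of the stable span in degree `e ≥ d`, then so are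
their multiples of degree `e`. -/
theorem leadingTerms_stableSpan_of_le (hσ : DegCompat σ) {e : ℕ} (hde : d ≤ e)
    (hcov : ∀ t : Fin n →₀ ℕ, t.degree = d → t ∈ leadingTerms σ (stableSpan F e))
    (t : Fin n →₀ ℕ) (ht : t.degree = e) : t ∈ leadingTerms σ (stableSpan F e) := by
  classical
  obtain ⟨t', hle, ht'⟩ := Finsupp.exists_le_degree_eq t d (hde.trans ht.ge)
  obtain ⟨g, hg, h0, hgt⟩ := hcov t' ht'
  have hm : (monomial (t - t') (1 : K)) ≠ 0 := by simp [monomial_eq_zero]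
  have hadd : t - t' + t' = t := tsub_add_cancel_of_le hle
  refine ⟨monomial (t - t') 1 * g, monomial_mul_mem_stableSpan hg _ ?_, mul_ne_zero hm h0, ?_⟩
  · rw [← hσ.degree_degree, hgt, ← map_add, hadd, ht]
  · rw [σ.degree_mul hm h0, σ.degree_monomial, if_neg one_ne_zero, hgt, hadd]

/-- If all terms of degree `d` are leading terms of `U`, then polynomials of degree `≤ d` can be
reduced modulo `U` to degree `< d`. -/
theorem degLT_succ_le_sup (hσ : DegCompat σ) {U : Submodule K (MvPolynomial (Fin n) K)}
    (hcov : ∀ t : Fin n →₀ ℕ, t.degree = d → t ∈ leadingTerms σ U) :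
    degLT K n (d + 1) ≤ U ⊔ degLT K n d := by
  have key : ∀ (s : σ.syn) (t : Fin n →₀ ℕ), σ.toSyn t = s → t.degree ≤ d →
      monomial t (1 : K) ∈ U ⊔ degLT K n d := by
    intro s
    induction s using WellFoundedLT.induction with
    | ind s ih =>
      rintro t rfl ht
      rcases ht.lt_or_eq with hlt | heq
      · exact Submodule.mem_sup_right (monomial_mem_degLT hlt 1)
      · obtain ⟨g, hg, h0, hgt⟩ := hcov t heq
        have hc : coeff t g ≠ 0 := by rw [← hgt]; exact σ.coeff_degree_ne_zero_iff.2 h0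
        -- the lower terms of an element with leading term `t` are treated by induction
        have hrest : ∑ u ∈ g.support.erase t, monomial u (coeff u g) ∈ U ⊔ degLT K n d := by
          refine Submodule.sum_mem _ fun u hu => ?_
          have hu' := Finset.mem_erase.1 hu
          have hle : σ.toSyn u ≤ σ.toSyn t := by rw [← hgt]; exact σ.le_degree hu'.2
          have hlt : σ.toSyn u < σ.toSyn t :=
            lt_of_le_of_ne hle fun h => hu'.1 (σ.toSyn.injective h)
          have := ih _ hlt u rfl ((hσ.degree_le hle).trans ht)
          have h2 := Submodule.smul_mem _ (coeff u g) this
          rwa [smul_monomial, smul_eq_mul, mul_one] at h2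
        have hsum : monomial t (coeff t g) +
            ∑ u ∈ g.support.erase t, monomial u (coeff u g) = g := by
          rw [Finset.add_sum_erase _ (fun u => monomial u (coeff u g)) (mem_support_iff.2 hc)]
          exact support_sum_monomial_coeff g
        have h3 : monomial t (coeff t g) ∈ U ⊔ degLT K n d := by
          rw [eq_sub_iff_add_eq.2 hsum]
          exact Submodule.sub_mem _ (Submodule.mem_sup_left hg) hrest
        have h4 := Submodule.smul_mem _ (coeff t g)⁻¹ h3
        rwa [smul_monomial, smul_eq_mul, inv_mul_cancel₀ hc] at h4
  refine mem_of_monomial_mem fun t ht => key _ t rfl ?_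
  exact Nat.lt_succ_iff.1 (mem_termsLT.1 ht)

/-- A linear normal form modulo `U` with values in degree `< d`. -/
theorem exists_normalForm {U : Submodule K (MvPolynomial (Fin n) K)}
    (h : degLT K n (d + 1) ≤ U ⊔ degLT K n d) :
    ∃ s : (MvPolynomial (Fin n) K ⧸ U) →ₗ[K] MvPolynomial (Fin n) K,
      (∀ a, s a ∈ degLT K n d) ∧ ∀ p ∈ degLT K n (d + 1), p - s (U.mkQ p) ∈ U := by
  set q := U.mkQ.domRestrict (degLT K n d) with hq
  obtain ⟨s₀, hs₀⟩ := q.rangeRestrict.exists_rightInverse_of_surjective q.range_rangeRestrict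
  obtain ⟨s₁, hs₁⟩ := LinearMap.exists_extend s₀
  refine ⟨(degLT K n d).subtype ∘ₗ s₁, fun a => (s₁ a).2, fun p hp => ?_⟩
  obtain ⟨u, hu, r, hr, rfl⟩ := Submodule.mem_sup.1 (h hp)
  have hmem : U.mkQ (u + r) ∈ LinearMap.range q := by
    refine ⟨⟨r, hr⟩, ?_⟩
    rw [map_add, (Submodule.Quotient.mk_eq_zero U).2 hu |> (fun h => (h : U.mkQ u = 0)), zero_add]
    rfl
  have h1 : s₁ (U.mkQ (u + r)) = s₀ ⟨_, hmem⟩ := LinearMap.congr_fun hs₁ ⟨_, hmem⟩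
  have h2 : q (s₀ ⟨_, hmem⟩) = U.mkQ (u + r) :=
    congrArg Subtype.val (LinearMap.congr_fun hs₀ ⟨_, hmem⟩)
  rw [← Submodule.Quotient.eq]
  change U.mkQ (u + r) = U.mkQ (s₁ (U.mkQ (u + r)))
  rw [h1]
  exact h2.symm

open scoped IsMulCommutative in
/-- Commuting endomorphisms `T j` make a vector space a module over the polynomial ring. -/
theorem exists_algHom_of_commute {A : Type*} [AddCommGroup A] [Module K A]
    (T : Fin n → Module.End K A) (hT : ∀ i j, T i * T j = T j * T i) :
    ∃ φ : MvPolynomial (Fin n) K →ₐ[K] Module.End K A, ∀ j, φ (X j) = T j := by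
  have := Algebra.isMulCommutative_adjoin K (s := Set.range T) (by
    rintro _ ⟨i, rfl⟩ _ ⟨j, rfl⟩
    exact hT i j)
  refine ⟨(Algebra.adjoin K (Set.range T)).val.comp
    (aeval fun j => ⟨T j, Algebra.subset_adjoin ⟨j, rfl⟩⟩), fun j => ?_⟩
  simp

/-- Mourrain's criterion: let `U` be stable in degree `≤ d`, and let all polynomials of degree `≤ d`
reduce modulo `U` to degree `< d`. If `U` contains the polynomials `F` of degree `≤ d`, then it
contains all elements of degree `≤ d` of the ideal generated by `F`. -/
theorem mem_of_isStable {U : Submodule K (MvPolynomial (Fin n) K)} (hU : IsStable d U)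
    (hcov : degLT K n (d + 1) ≤ U ⊔ degLT K n d)
    (hF : (F : Set (MvPolynomial (Fin n) K)) ⊆ U) (hFd : ∀ f ∈ F, f.totalDegree ≤ d)
    {p : MvPolynomial (Fin n) K} (hp : p ∈ Ideal.span (F : Set (MvPolynomial (Fin n) K)))
    (hpd : p.totalDegree ≤ d) : p ∈ U := by
  obtain ⟨s, hs, hsU⟩ := exists_normalForm hcov
  let T : Fin n → Module.End K (MvPolynomial (Fin n) K ⧸ U) := fun j =>
    U.mkQ ∘ₗ LinearMap.mulRight K (X j) ∘ₗ s
  have hmk : ∀ x y, U.mkQ x = U.mkQ y ↔ x - y ∈ U := fun _ _ => Submodule.Quotient.eq U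
  have hTapp : ∀ j a, T j a = U.mkQ (s a * X j) := fun _ _ => rfl
  have hcomm : ∀ i j, T i * T j = T j * T i := by
    intro i j
    refine LinearMap.ext fun a => ?_
    obtain ⟨a, rfl⟩ := U.mkQ_surjective a
    rw [Module.End.mul_apply, Module.End.mul_apply, hTapp, hTapp, hTapp, hTapp]
    rw [hmk]
    have hi := hsU _ (mul_X_mem_degLT (hs (U.mkQ a)) i)
    have hj := hsU _ (mul_X_mem_degLT (hs (U.mkQ a)) j)
    set x := s (U.mkQ a)
    -- the difference of the two ways to reduce `x * X i * X j`
    refine hU _ ?_ (mem_degLT_succ.1 (Submodule.sub_mem _ (mul_X_mem_degLT (hs _) i)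
      (mul_X_mem_degLT (hs _) j)))
    have h2 := Submodule.sub_mem _ (mul_X_mem_extension hi j) (mul_X_mem_extension hj i)
    convert h2 using 1
    simp only [Submodule.mkQ_apply]
    ring
  obtain ⟨φ, hφ⟩ := exists_algHom_of_commute T hcomm
  have hφT : ∀ t : Fin n →₀ ℕ, t.degree ≤ d →
      φ (monomial t 1) (U.mkQ 1) = U.mkQ (monomial t 1) := by
    intro t
    induction t using term_induction with
    | h0 => intro _; change φ 1 _ = U.mkQ 1; rw [map_one]; rfl
    | hs t j ih =>
      intro ht
      rw [degree_add_single] at ht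
      rw [monomial_succ, mul_comm, map_mul, Module.End.mul_apply, ih (by omega), hφ, hTapp, hmk]
      have hmem := monomial_mem_degLT (K := K) (show t.degree < d by omega) 1
      have h1 := hsU _ (degLT_mono (Nat.le_succ d) hmem)
      refine hU _ ?_ (mem_degLT_succ.1 (Submodule.sub_mem _ (mul_X_mem_degLT (hs _) j)
        ((mul_comm (monomial t (1 : K)) (X j)) ▸ mul_X_mem_degLT hmem j)))
      convert Submodule.neg_mem _ (mul_X_mem_extension h1 j) using 1
      simp only [Submodule.mkQ_apply]
      ring
  have hφp : ∀ q ∈ degLT K n (d + 1), φ q (U.mkQ 1) = U.mkQ q := by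
    intro q hq
    have : degLT K n (d + 1) ≤ LinearMap.eqLocus
        ((LinearMap.applyₗ (U.mkQ 1)) ∘ₗ φ.toLinearMap) U.mkQ := by
      refine mem_of_monomial_mem fun t ht => ?_
      exact hφT t (Nat.lt_succ_iff.1 (mem_termsLT.1 ht))
    exact this hq
  have hzero : ∀ q ∈ Ideal.span (F : Set (MvPolynomial (Fin n) K)), φ q (U.mkQ 1) = 0 := by
    intro q hq
    induction hq using Submodule.span_induction with
    | mem f hf =>
      rw [hφp f (mem_degLT_succ.2 (hFd f hf))]
      exact (Submodule.Quotient.mk_eq_zero U).2 (hF hf)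
    | zero => rw [map_zero]; rfl
    | add p q _ _ hp hq => rw [map_add, LinearMap.add_apply, hp, hq, add_zero]
    | smul r p _ hp => rw [smul_eq_mul, map_mul, Module.End.mul_apply, hp, map_zero]
  have hp0 := hzero p hp
  rw [hφp p (mem_degLT_succ.2 hpd)] at hp0
  exact (Submodule.Quotient.mk_eq_zero U).1 hp0

end StableSpan

section Colength

variable {K : Type*} [Field K] {n : ℕ} {σ : MonomialOrder (Fin n)}
  {F : Finset (MvPolynomial (Fin n) K)} {d : ℕ} {I : Ideal (MvPolynomial (Fin n) K)}

/-! ### Truncations of an ideal of finite colength -/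

theorem mem_leadingTerms_of_le_degree
    (hcov : ∀ t : Fin n →₀ ℕ, t.degree = d → t ∈ leadingTerms σ (I.restrictScalars K))
    {t : Fin n →₀ ℕ} (ht : d ≤ t.degree) : t ∈ leadingTerms σ (I.restrictScalars K) := by
  obtain ⟨t', hle, ht'⟩ := Finsupp.exists_le_degree_eq t d ht
  rw [← tsub_add_cancel_of_le hle]
  exact mem_leadingTerms_add (hcov t' ht') _

theorem sup_degLT_eq_top
    (hcov : ∀ t : Fin n →₀ ℕ, t.degree = d → t ∈ leadingTerms σ (I.restrictScalars K)) :
    I.restrictScalars K ⊔ degLT K n d = ⊤ := by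
  refine eq_top_iff.2 fun p _ => ?_
  obtain ⟨r, hr, hpr⟩ := exists_sub_mem σ I p
  rw [← sub_add_cancel p r]
  refine Submodule.add_mem_sup hpr (mem_degLT.2 fun t ht => ?_)
  by_contra hlt
  exact hr ht (mem_leadingTerms_of_le_degree hcov (not_lt.1 hlt))

/-- The polynomials of degree `< e` map onto the quotient by `I`, with kernel `I ∩ K[X]_{< e}`. -/
theorem finrank_quotient_add_finrank {e : ℕ} (h : I.restrictScalars K ⊔ degLT K n e = ⊤) :
    Module.finrank K (MvPolynomial (Fin n) K ⧸ I) +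
      Module.finrank K (I.restrictScalars K ⊓ degLT K n e : Submodule K (MvPolynomial (Fin n) K)) =
      (termsLT n e).card := by
  set q := (Ideal.Quotient.mkₐ K I).toLinearMap.domRestrict (degLT K n e) with hq
  have hker : (LinearMap.ker q).map (degLT K n e).subtype = I.restrictScalars K ⊓ degLT K n e := by
    ext p
    simp only [Submodule.mem_map, LinearMap.mem_ker, Submodule.subtype_apply, Submodule.mem_inf,
      Submodule.restrictScalars_mem]
    constructor
    · rintro ⟨⟨p, hp⟩, h0, rfl⟩
      exact ⟨Ideal.Quotient.eq_zero_iff_mem.1 h0, hp⟩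
    · rintro ⟨hpI, hp⟩
      exact ⟨⟨p, hp⟩, Ideal.Quotient.eq_zero_iff_mem.2 hpI, rfl⟩
  have hrange : LinearMap.range q = ⊤ := by
    refine LinearMap.range_eq_top.2 fun a => ?_
    obtain ⟨p, rfl⟩ := Ideal.Quotient.mk_surjective a
    obtain ⟨i, hi, r, hr, hp⟩ := Submodule.mem_sup.1 (h ▸ Submodule.mem_top :
      p ∈ I.restrictScalars K ⊔ degLT K n e)
    refine ⟨⟨r, hr⟩, ?_⟩
    refine (Ideal.Quotient.eq.2 ?_ : Ideal.Quotient.mk I r = Ideal.Quotient.mk I p)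
    rw [← hp, ← neg_sub, add_sub_cancel_right]
    exact I.neg_mem hi
  have h1 := q.finrank_range_add_finrank_ker
  rw [hrange, finrank_top] at h1
  rw [← hker, Submodule.finrank_map_subtype_eq, h1]
  exact finrank_restrictSupport _

theorem stableSpan_eq (hσ : DegCompat σ) (hF : ∀ f ∈ F, f.totalDegree ≤ d)
    (hI : I = Ideal.span (F : Set (MvPolynomial (Fin n) K)))
    (hcov : ∀ t : Fin n →₀ ℕ, t.degree = d → t ∈ leadingTerms σ (stableSpan F d)) :
    stableSpan F d = I.restrictScalars K ⊓ degLT K n (d + 1) := by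
  apply le_antisymm
  · refine le_inf (stableSpan_le_ideal fun f hf => ?_) (stableSpan_le_degLT hF)
    rw [hI]
    exact Ideal.subset_span hf
  · rintro p ⟨hpI, hpd⟩
    exact mem_of_isStable (isStable_stableSpan F d) (degLT_succ_le_sup hσ hcov)
      (subset_stableSpan F d) hF (hI ▸ hpI) (mem_degLT_succ.1 hpd)

theorem leadingTerms_of_stableSpan (hI : I = Ideal.span (F : Set (MvPolynomial (Fin n) K)))
    (hcov : ∀ t : Fin n →₀ ℕ, t.degree = d → t ∈ leadingTerms σ (stableSpan F d))
    (t : Fin n →₀ ℕ) (ht : t.degree = d) : t ∈ leadingTerms σ (I.restrictScalars K) :=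
  leadingTerms_mono σ (stableSpan_le_ideal fun f hf => by rw [hI]; exact Ideal.subset_span hf)
    (hcov t ht)

theorem finrank_quotient_add_finrank_stableSpan (hσ : DegCompat σ)
    (hF : ∀ f ∈ F, f.totalDegree ≤ d)
    (hI : I = Ideal.span (F : Set (MvPolynomial (Fin n) K)))
    (hcov : ∀ t : Fin n →₀ ℕ, t.degree = d → t ∈ leadingTerms σ (stableSpan F d)) :
    Module.finrank K (MvPolynomial (Fin n) K ⧸ I) + Module.finrank K (stableSpan F d) =
      (termsLE n d).card := by
  rw [stableSpan_eq hσ hF hI hcov]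
  refine finrank_quotient_add_finrank (eq_top_iff.2 ?_)
  rw [← sup_degLT_eq_top (leadingTerms_of_stableSpan hI hcov)]
  exact sup_le_sup_left (degLT_mono (Nat.le_succ d)) _

/-- All terms whose degree is at least the colength of `I` are leading terms of `I`. -/
theorem mem_leadingTerms_of_finrank_le (σ : MonomialOrder (Fin n))
    (hfin : FiniteDimensional K (MvPolynomial (Fin n) K ⧸ I)) {t : Fin n →₀ ℕ}
    (ht : Module.finrank K (MvPolynomial (Fin n) K ⧸ I) ≤ t.degree) :
    t ∈ leadingTerms σ (I.restrictScalars K) := by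
  obtain ⟨O, hO, hOσ⟩ := exists_admissible σ hfin
  rw [mem_admissible_iff] at hO
  by_contra hlt
  have htO : t ∈ O := by rw [← Finset.mem_coe, hOσ]; exact hlt
  have := hO.1.degree_lt_card htO
  rw [card_of_isCompl hO.2] at this
  omega

theorem sup_degLT_finrank_eq_top
    (hfin : FiniteDimensional K (MvPolynomial (Fin n) K ⧸ I)) :
    I.restrictScalars K ⊔ degLT K n (Module.finrank K (MvPolynomial (Fin n) K ⧸ I)) = ⊤ :=
  sup_degLT_eq_top (σ := MonomialOrder.lex) fun _ ht =>
    mem_leadingTerms_of_finrank_le _ hfin ht.ge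

/-- An ideal of colength `δ` is generated by its elements of degree `≤ δ`. -/
theorem ideal_span_eq (hσ : DegCompat σ)
    (hfin : FiniteDimensional K (MvPolynomial (Fin n) K ⧸ I))
    {M : Finset (MvPolynomial (Fin n) K)}
    (hM : Submodule.span K (M : Set (MvPolynomial (Fin n) K)) = I.restrictScalars K ⊓
      degLT K n (Module.finrank K (MvPolynomial (Fin n) K ⧸ I) + 1)) :
    Ideal.span (M : Set (MvPolynomial (Fin n) K)) = I := by
  set J := Ideal.span (M : Set (MvPolynomial (Fin n) K)) with hJ
  set δ := Module.finrank K (MvPolynomial (Fin n) K ⧸ I) with hδ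
  have hMJ : Submodule.span K (M : Set (MvPolynomial (Fin n) K)) ≤ J.restrictScalars K :=
    Submodule.span_le.2 Ideal.subset_span
  have hJI : J ≤ I := by
    rw [hJ, Ideal.span_le]
    intro m hm
    exact (hM.le (Submodule.subset_span hm)).1
  have htop : J.restrictScalars K ⊔ degLT K n δ = ⊤ := by
    refine sup_degLT_eq_top (σ := σ) fun t ht => leadingTerms_mono σ hMJ ?_
    obtain ⟨g, hg, h0, hgt⟩ := mem_leadingTerms_of_finrank_le σ hfin ht.ge
    refine ⟨g, ?_, h0, hgt⟩
    rw [hM]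
    exact ⟨hg, mem_degLT_succ.2 (by rw [← hσ.degree_degree, hgt, ht])⟩
  refine le_antisymm hJI fun p hp => ?_
  obtain ⟨q, hq, r, hr, rfl⟩ := Submodule.mem_sup.1 (htop ▸ Submodule.mem_top :
      p ∈ J.restrictScalars K ⊔ degLT K n δ)
  refine J.add_mem hq (hMJ ?_)
  rw [hM]
  refine ⟨?_, degLT_mono (Nat.le_succ δ) hr⟩
  have := I.sub_mem hp (hJI hq)
  rwa [add_sub_cancel_left] at this

/-- In large degrees all terms are leading terms of the stable span. -/
theorem exists_forall_leadingTerms_stableSpan (hσ : DegCompat σ)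
    (hI : I = Ideal.span (F : Set (MvPolynomial (Fin n) K)))
    (hfin : FiniteDimensional K (MvPolynomial (Fin n) K ⧸ I)) :
    ∃ d₀, ∀ d, d₀ ≤ d → ∀ t : Fin n →₀ ℕ, t.degree = d → t ∈ leadingTerms σ (stableSpan F d) := by
  set δ := Module.finrank K (MvPolynomial (Fin n) K ⧸ I) with hδ
  have hex : ∀ t : Fin n →₀ ℕ, ∃ e, t.degree = δ → t ∈ leadingTerms σ (stableSpan F e) := by
    intro t
    by_cases ht : t.degree = δ
    · obtain ⟨g, hg, h0, hgt⟩ := mem_leadingTerms_of_finrank_le σ hfin ht.ge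
      obtain ⟨e, he⟩ := exists_mem_stableSpan (F := F) (hI ▸ hg)
      exact ⟨e, fun _ => ⟨g, he, h0, hgt⟩⟩
    · exact ⟨0, fun h => absurd h ht⟩
  choose e he using hex
  refine ⟨max δ ((termsLE n δ).sup e), fun d hd => ?_⟩
  refine leadingTerms_stableSpan_of_le hσ ((le_max_left _ _).trans hd) fun t ht => ?_
  have hmem : t ∈ termsLE n δ := mem_termsLT.2 (by omega)
  exact leadingTerms_mono σ (stableSpan_mono
    ((Finset.le_sup hmem).trans ((le_max_right _ _).trans hd))) (he t ht)

/-- With a degree-compatible ordering a basis in echelon form restricts to each truncation. -/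
theorem IsEchelon.span_filter (hσ : DegCompat σ) {M : Finset (MvPolynomial (Fin n) K)}
    (hM : IsEchelon Set.univ σ.degree M) (e : ℕ) :
    Submodule.span K (M.filter fun g => g.totalDegree < e : Set (MvPolynomial (Fin n) K)) =
      Submodule.span K (M : Set (MvPolynomial (Fin n) K)) ⊓ degLT K n e := by
  apply le_antisymm
  · rw [Submodule.span_le]
    intro g hg
    simp only [Finset.coe_filter, Set.mem_ofPred_eq] at hg
    exact ⟨Submodule.subset_span hg.1, mem_degLT_of_totalDegree_lt hg.2⟩
  · rintro p ⟨hp, hpe⟩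
    obtain ⟨c, rfl⟩ := exists_sum_of_mem_span hp
    refine Submodule.sum_mem _ fun b hb => ?_
    by_cases hcb : c b = 0
    · rw [hcb, zero_smul]; exact Submodule.zero_mem _
    · refine Submodule.smul_mem _ _ (Submodule.subset_span ?_)
      obtain ⟨h0, m, hm, hme, hmax⟩ := hM.exists_head (isHead_degree σ) ⟨b, hb, hcb⟩
      rw [Finset.mem_coe, Finset.mem_filter]
      refine ⟨hb, lt_of_le_of_lt ?_ (totalDegree_lt_of_mem_degLT hpe h0)⟩
      rw [← hσ.degree_degree, ← hσ.degree_degree, ← hme]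
      exact hσ.degree_le (hmax b hb hcb)

end Colength

section Stab

variable {K : Type*} [Field K] {n : ℕ} {σ : MonomialOrder (Fin n)}
  {F : Finset (MvPolynomial (Fin n) K)} {d : ℕ}

/-! ### Computation of the stable span -/

/-- The set `V` of `LStabSpan(F, d)` between two eliminations. -/
structure StabBasis (σ : MonomialOrder (Fin n)) (F : Finset (MvPolynomial (Fin n) K)) (d : ℕ)
    (V : Finset (MvPolynomial (Fin n) K)) : Prop where
  echelon : IsEchelon Set.univ σ.degree V
  subset : (F : Set (MvPolynomial (Fin n) K)) ⊆ Submodule.span K (V : Set (MvPolynomial (Fin n) K))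
  le : Submodule.span K (V : Set (MvPolynomial (Fin n) K)) ≤ stableSpan F d

open Classical in
/-- The invariant of `LStabSpan(F, d)`. -/
def StabInv (σ : MonomialOrder (Fin n)) (F : Finset (MvPolynomial (Fin n) K)) (d : ℕ) :
    StabState K n → Prop
  | .init s => GaussInv Set.univ σ.degree ∅ F s
  | .extend V s => StabBasis σ F d V ∧
      GaussInv Set.univ σ.degree V (neighborhood V \ V) s
  | .ret V => IsEchelon Set.univ σ.degree V ∧
      Submodule.span K (V : Set (MvPolynomial (Fin n) K)) = stableSpan F d

theorem mem_restrictSupport_univ (p : MvPolynomial (Fin n) K) :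
    p ∈ restrictSupport K Set.univ := by
  rw [restrictSupport_univ]; trivial

theorem StabInv.start : StabInv σ F d (StabState.start F) :=
  GaussInv.start IsEchelon.empty fun _ _ => mem_restrictSupport_univ _

theorem StabBasis.call {V : Finset (MvPolynomial (Fin n) K)} (hV : StabBasis σ F d V) :
    StabInv σ F d (StabState.call V) :=
  ⟨hV, GaussInv.start hV.echelon fun _ _ => mem_restrictSupport_univ _⟩

open Classical in
theorem span_sup_neighborhood (V : Finset (MvPolynomial (Fin n) K)) :
    Submodule.span K (V : Set (MvPolynomial (Fin n) K)) ⊔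
      Submodule.span K ((neighborhood V \ V : Finset _) : Set (MvPolynomial (Fin n) K)) =
    extension (Submodule.span K (V : Set (MvPolynomial (Fin n) K))) := by
  have hV : V ⊆ neighborhood V := by
    unfold neighborhood
    intro v hv
    exact Finset.mem_union_left _ hv
  rw [← Submodule.span_union, ← Finset.coe_union, Finset.union_sdiff_of_subset hV,
    span_neighborhood]

open Classical in
/-- The result `W'` of the elimination extends `V` to a basis of the extension. -/
theorem span_union_of_returns {V W' : Finset (MvPolynomial (Fin n) K)} {s : GaussState K n}
    (hs : GaussInv Set.univ σ.degree V (neighborhood V \ V) s) (hret : s.Returns W') :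
    IsEchelon Set.univ σ.degree (V ∪ W') ∧ Disjoint V W' ∧
    Submodule.span K ((V ∪ W' : Finset _) : Set (MvPolynomial (Fin n) K)) =
      extension (Submodule.span K (V : Set (MvPolynomial (Fin n) K))) := by
  have h := hs.span_eq_of_returns hret
  rw [span_sup_neighborhood, ← Submodule.span_union, ← Finset.coe_union] at h
  have h1 := hs.echelon
  have h2 := hs.disjoint
  rw [hs.V_eq, hret.2.2] at h1 h2
  exact ⟨h1, h2, h⟩

open Classical in
theorem StabInv.step (hσ : DegCompat σ) {s s' : StabState K n}
    (hs : StabInv σ F d s) (hstep : StabStep σ d s s') :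
    StabInv σ F d s' := by
  cases hstep with
  | init_step s s' h => exact GaussInv.step (isHead_degree σ) hs h
  | extend_step V s s' h => exact ⟨hs.1, GaussInv.step (isHead_degree σ) hs.2 h⟩
  | init_ret s V hret =>
    have hs : GaussInv Set.univ σ.degree ∅ F s := hs
    have h1 := hs.span_eq_of_returns hret
    simp only [Finset.coe_empty, Submodule.span_empty, bot_sup_eq] at h1
    have h2 := hs.echelon
    rw [hs.V_eq, hret.2.2, Finset.empty_union] at h2
    refine StabBasis.call ⟨h2, ?_, ?_⟩
    · rw [h1]; exact Submodule.subset_span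
    · rw [h1]; exact Submodule.span_le.2 (subset_stableSpan F d)
  | extend_more V W' s hret hne =>
    obtain ⟨hV, hs⟩ := hs
    obtain ⟨h1, h2, h3⟩ := span_union_of_returns hs hret
    refine StabBasis.call ⟨h1.mono ?_, ?_, ?_⟩
    · exact Finset.union_subset_union_right (Finset.filter_subset _ _)
    · exact hV.subset.trans (Submodule.span_mono (by simp))
    · rw [Finset.coe_union, Submodule.span_union]
      refine sup_le hV.le (Submodule.span_le.2 fun w hw => ?_)
      obtain ⟨hw, hwd⟩ := Finset.mem_filter.1 hw
      refine isStable_stableSpan F d w (extension_mono hV.le ?_) hwd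
      rw [← h3]
      exact Submodule.subset_span (Finset.mem_coe.2 (Finset.mem_union_right _ hw))
  | extend_done V W' s hret he =>
    obtain ⟨hV, hs⟩ := hs
    obtain ⟨h1, h2, h3⟩ := span_union_of_returns hs hret
    refine ⟨hV.echelon, le_antisymm hV.le (stableSpan_le hV.subset fun p hp hpd => ?_)⟩
    rw [← h3] at hp
    have hmem : p ∈ Submodule.span K ((V ∪ W' : Finset _) : Set (MvPolynomial (Fin n) K)) ⊓
      degLT K n (d + 1) := ⟨hp, mem_degLT_succ.2 hpd⟩
    rw [← h1.span_filter hσ (d + 1)] at hmem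
    refine Submodule.span_mono ?_ hmem
    intro w hw
    obtain ⟨hw, hwd⟩ := Finset.mem_filter.1 hw
    rcases Finset.mem_union.1 hw with hw | hw
    · exact hw
    · have : w ∈ W'.filter fun w => w.totalDegree ≤ d :=
        Finset.mem_filter.2 ⟨hw, Nat.lt_succ_iff.1 hwd⟩
      rw [he] at this
      simp at this

theorem StabBasis.card_le (hF : ∀ f ∈ F, f.totalDegree ≤ d)
    {V : Finset (MvPolynomial (Fin n) K)} (hV : StabBasis σ F d V) :
    V.card ≤ Module.finrank K (degLT K n (d + 1)) := by
  rw [← hV.echelon.finrank_span (isHead_degree σ)]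
  exact Submodule.finrank_mono (hV.le.trans (stableSpan_le_degLT hF))

theorem acc_ret (V : Finset (MvPolynomial (Fin n) K)) :
    Acc (fun a b => StabStep σ d b a) (.ret V) := ⟨_, fun s' h => by cases h⟩

/-- The extension loop of `LStabSpan` is finite, since each round adds to `V` some polynomials that
are linearly independent of it. -/
theorem StabBasis.acc_extend (hσ : DegCompat σ) (hF : ∀ f ∈ F, f.totalDegree ≤ d)
    {V : Finset (MvPolynomial (Fin n) K)} {s : GaussState K n}
    (hs : StabInv σ F d (.extend V s)) : Acc (fun a b => StabStep σ d b a) (.extend V s) := by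
  classical
  induction hk : Module.finrank K (degLT K n (d + 1)) - V.card using Nat.strong_induction_on
    generalizing V s with
  | _ k ihk =>
    have hacc := GaussInv.acc (isHead_degree σ) hs.2
    induction hacc with
    | intro s _ ih =>
      refine ⟨_, fun s' hstep => ?_⟩
      have hs' := hs.step hσ hstep
      cases hstep with
      | extend_step _ _ s' h => exact ih s' h hs'
      | extend_more _ W' _ hret hne =>
        obtain ⟨h1, h2, h3⟩ := span_union_of_returns hs.2 hret
        have hc := (StabBasis.card_le hF hs'.1 :)
        refine ihk _ ?_ hs' rfl
        have hd : Disjoint V (W'.filter fun w => w.totalDegree ≤ d) :=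
          h2.mono_right (Finset.filter_subset _ _)
        have hpos := hne.card_pos
        rw [Finset.card_union_of_disjoint hd] at hc ⊢
        omega
      | extend_done _ _ _ _ _ => exact acc_ret V

theorem StabInv.acc (hσ : DegCompat σ) (hF : ∀ f ∈ F, f.totalDegree ≤ d)
    {s : StabState K n} (hs : StabInv σ F d s) : Acc (fun a b => StabStep σ d b a) s := by
  cases s with
  | ret V => exact acc_ret V
  | extend V s => exact StabBasis.acc_extend hσ hF hs
  | init s =>
    have hacc := GaussInv.acc (isHead_degree σ) hs
    induction hacc with
    | intro s _ ih =>
      refine ⟨_, fun s' hstep => ?_⟩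
      have hs' := hs.step hσ hstep
      cases hstep with
      | init_step _ s' h => exact ih s' h hs'
      | init_ret _ V hret => exact StabBasis.acc_extend hσ hF hs'

theorem StabState.exists_step_or_ret (σ : MonomialOrder (Fin n)) (d : ℕ) (s : StabState K n) :
    (∃ s', StabStep σ d s s') ∨ ∃ V, s = .ret V := by
  cases s with
  | ret V => exact Or.inr ⟨V, rfl⟩
  | init s =>
    left
    rcases s.exists_step_or_returns σ.degree with ⟨s', h⟩ | ⟨W, h⟩
    · exact ⟨_, .init_step s s' h⟩
    · exact ⟨_, .init_ret s W h⟩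
  | extend V s =>
    left
    rcases s.exists_step_or_returns σ.degree with ⟨s', h⟩ | ⟨W, h⟩
    · exact ⟨_, .extend_step V s s' h⟩
    · rcases (W.filter fun w => w.totalDegree ≤ d).eq_empty_or_nonempty with he | hne
      · exact ⟨_, .extend_done V W s h he⟩
      · exact ⟨_, .extend_more V W s h hne⟩

end Stab

section Trans

variable {K : Type*} [Field K] {n : ℕ} {I : Ideal (MvPolynomial (Fin n) K)}
  {O : Finset (Fin n →₀ ℕ)}

/-! ### Basis transformation -/

/-- The first element of `l` that satisfies `p` comes no later than any other such element. -/
theorem find?_getD_spec {β : Type*} [DecidableEq β] (z : β) (p : β → Bool) (l : List β) {t : β}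
    (ht : t ∈ l) (hp : p t = true) :
    p ((l.find? p).getD z) = true ∧ l.idxOf ((l.find? p).getD z) ≤ l.idxOf t := by
  induction l with
  | nil => simp at ht
  | cons a l ih =>
    by_cases ha : p a = true
    · rw [List.find?_cons_of_pos ha]
      simp [ha]
    · rw [List.find?_cons_of_neg ha]
      have hat : t ≠ a := by rintro rfl; exact ha hp
      obtain ⟨h1, h2⟩ := ih (List.mem_of_ne_of_mem hat ht)
      refine ⟨h1, ?_⟩
      rw [List.idxOf_cons_ne _ hat.symm, List.idxOf_cons_ne]
      · exact Nat.succ_le_succ h2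
      · intro h; rw [← h] at h1; exact ha h1

/-- The position of a column, counted from the right. -/
def rank (cols : List (Fin n →₀ ℕ)) (t : Fin n →₀ ℕ) : ℕ := cols.length - cols.idxOf t

theorem isHead_head (cols : List (Fin n →₀ ℕ)) :
    IsHead K {t | t ∈ cols} (head (K := K) cols) (rank cols) := by
  refine ⟨fun a ha b hb hab => ?_, fun f hf h0 => ?_, fun f hf t ht => ?_⟩
  · have h1 := List.idxOf_lt_length_of_mem ha
    have h2 := List.idxOf_lt_length_of_mem hb
    simp only [rank] at hab
    exact (List.idxOf_inj ha).1 (by omega)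
  · obtain ⟨t, ht⟩ := support_nonempty.2 h0
    have := (find?_getD_spec 0 (fun t => decide (t ∈ f.support)) cols (hf ht) (by simpa using ht)).1
    exact of_decide_eq_true this
  · have := (find?_getD_spec 0 (fun t => decide (t ∈ f.support)) cols (hf ht) (by simpa using ht)).2
    simp only [rank, head]
    omega

variable {D : Set (Fin n →₀ ℕ)} {hd : MvPolynomial (Fin n) K → (Fin n →₀ ℕ)}
  {ρ : (Fin n →₀ ℕ) → ℕ} {R : Finset (MvPolynomial (Fin n) K)}

/-- The support of a row, read as a binary number. -/
noncomputable def weight (ρ : (Fin n →₀ ℕ) → ℕ) (g : MvPolynomial (Fin n) K) : ℕ :=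
  ∑ t ∈ g.support, 2 ^ ρ t

theorem IsEchelon.rank_lt (h : IsHead K D hd ρ) (hR : IsEchelon D hd R)
    {g f : MvPolynomial (Fin n) K} (hg : g ∈ R) (hf : f ∈ R) (hne : g ≠ f)
    (hfg : hd f ∈ g.support) : ρ (hd f) < ρ (hd g) := by
  refine lt_of_le_of_ne (h.le_head g (hR.mem g hg) _ hfg) fun he => hne (hR.injOn hg hf ?_)
  exact (h.injOn (hR.mem f hf (hR.head_mem hf)) (hR.mem g hg (hR.head_mem hg)) he).symm

/-- Clearing the entry at the head of `f` only changes entries to the right of it, which together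
weigh less than the entry removed. -/
theorem IsEchelon.weight_lt (h : IsHead K D hd ρ) (hR : IsEchelon D hd R)
    {g f : MvPolynomial (Fin n) K} (hf : f ∈ R) (hfg : hd f ∈ g.support) :
    weight ρ (g - C (coeff (hd f) g) * f) < weight ρ g := by
  classical
  set g' := g - C (coeff (hd f) g) * f with hg'
  have hcoeff : ∀ t, coeff t g' = coeff t g - coeff (hd f) g * coeff t f := by
    intro t; rw [hg', coeff_sub, coeff_C_mul]
  have hz : hd f ∉ g'.support := by
    rw [notMem_support_iff, hcoeff, hR.monic f hf, mul_one, sub_self]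
  -- terms that were not in `g` come from `f`, below its head
  have hnew : ∀ t ∈ g'.support \ g.support, t ∈ D ∧ ρ t < ρ (hd f) := by
    intro t ht
    obtain ⟨ht, htg⟩ := Finset.mem_sdiff.1 ht
    have htf : t ∈ f.support := by
      rw [mem_support_iff, hcoeff, notMem_support_iff.1 htg] at ht
      rw [mem_support_iff]
      intro h0
      simp [h0] at ht
    have htD := hR.mem f hf htf
    refine ⟨htD, lt_of_le_of_ne (h.le_head f (hR.mem f hf) t htf) fun he => ?_⟩
    rw [h.injOn htD (hR.mem f hf (hR.head_mem hf)) he] at ht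
    exact hz ht
  have h1 : ∑ t ∈ g'.support \ g.support, 2 ^ ρ t < 2 ^ ρ (hd f) := by
    have hinj : Set.InjOn ρ (g'.support \ g.support : Finset (Fin n →₀ ℕ)) :=
      fun a ha b hb hab => h.injOn (hnew a ha).1 (hnew b hb).1 hab
    rw [← Finset.sum_image (f := fun k => 2 ^ k) hinj]
    refine Nat.geomSum_lt le_rfl fun k hk => ?_
    obtain ⟨t, ht, rfl⟩ := Finset.mem_image.1 hk
    exact (hnew t ht).2
  have h2 : ∑ t ∈ g'.support ∩ g.support, 2 ^ ρ t ≤ ∑ t ∈ g.support.erase (hd f), 2 ^ ρ t := by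
    refine Finset.sum_le_sum_of_subset fun t ht => ?_
    obtain ⟨ht, htg⟩ := Finset.mem_inter.1 ht
    exact Finset.mem_erase.2 ⟨by rintro rfl; exact hz ht, htg⟩
  have h3 := Finset.sum_inter_add_sum_sdiff g'.support g.support (fun t => 2 ^ ρ t)
  have h4 := Finset.sum_erase_add g.support (fun t => 2 ^ ρ t) hfg
  unfold weight
  omega

open Classical in
/-- A step of the back substitution keeps the echelon form and the span. -/
theorem IsEchelon.back_step (h : IsHead K D hd ρ) (hR : IsEchelon D hd R)
    {g f : MvPolynomial (Fin n) K} (hg : g ∈ R) (hf : f ∈ R) (hne : g ≠ f)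
    (hfg : hd f ∈ g.support) :
    IsEchelon D hd (insert (g - C (coeff (hd f) g) * f) (R.erase g)) ∧
    Submodule.span K ((insert (g - C (coeff (hd f) g) * f) (R.erase g) : Finset _) :
      Set (MvPolynomial (Fin n) K)) = Submodule.span K (R : Set (MvPolynomial (Fin n) K)) ∧
    ∑ r ∈ insert (g - C (coeff (hd f) g) * f) (R.erase g), weight ρ r < ∑ r ∈ R, weight ρ r := by
  have hlt := hR.rank_lt h hg hf hne hfg
  obtain ⟨hhd, hc⟩ := h.head_eq_of_sub (hR.mem g hg) (hR.mem f hf) (hR.ne_zero hg) hlt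
    (coeff (hd f) g)
  have hw := hR.weight_lt h hf hfg
  set g' := g - C (coeff (hd f) g) * f with hg'
  have hg'smul : g' = g - coeff (hd f) g • f := by rw [hg', C_mul']
  have hnotMem : g' ∉ R.erase g := by
    intro hmem
    obtain ⟨hne', hmem⟩ := Finset.mem_erase.1 hmem
    exact hne' (hR.injOn hmem hg hhd)
  refine ⟨⟨?_, ?_, ?_⟩, ?_, ?_⟩
  · intro b hb
    rcases Finset.mem_insert.1 hb with rfl | hb
    · rw [hg'smul]
      exact Submodule.sub_mem _ (hR.mem g hg) (Submodule.smul_mem _ _ (hR.mem f hf))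
    · exact hR.mem b (Finset.mem_of_mem_erase hb)
  · intro b hb
    rcases Finset.mem_insert.1 hb with rfl | hb
    · rw [hhd, hc, hR.monic g hg]
    · exact hR.monic b (Finset.mem_of_mem_erase hb)
  · intro a ha b hb hab
    rcases Finset.mem_insert.1 ha with rfl | ha <;> rcases Finset.mem_insert.1 hb with rfl | hb
    · rfl
    · obtain ⟨hbg, hb⟩ := Finset.mem_erase.1 hb
      exact absurd (hR.injOn hb hg (hab.symm.trans hhd)) hbg
    · obtain ⟨hag, ha⟩ := Finset.mem_erase.1 ha
      exact absurd (hR.injOn ha hg (hab.trans hhd)) hag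
    · exact hR.injOn (Finset.mem_of_mem_erase ha) (Finset.mem_of_mem_erase hb) hab
  · apply le_antisymm
    · rw [Submodule.span_le]
      intro b hb
      rcases Finset.mem_insert.1 (Finset.mem_coe.1 hb) with rfl | hb
      · rw [hg'smul]
        exact Submodule.sub_mem _ (Submodule.subset_span hg)
          (Submodule.smul_mem _ _ (Submodule.subset_span hf))
      · exact Submodule.subset_span (Finset.mem_of_mem_erase hb)
    · rw [Submodule.span_le]
      intro b hb
      by_cases hbg : b = g
      · have hf' : f ∈ insert g' (R.erase g) :=
          Finset.mem_insert_of_mem (Finset.mem_erase.2 ⟨hne.symm, hf⟩)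
        have : b = g' + coeff (hd f) g • f := by rw [hg'smul, sub_add_cancel, hbg]
        rw [this]
        exact Submodule.add_mem _ (Submodule.subset_span (Finset.mem_insert_self _ _))
          (Submodule.smul_mem _ _ (Submodule.subset_span hf'))
      · exact Submodule.subset_span
          (Finset.mem_insert_of_mem (Finset.mem_erase.2 ⟨hbg, hb⟩))
  · rw [Finset.sum_insert hnotMem, ← Finset.sum_erase_add R (weight ρ) hg]
    omega

/-- In reduced row echelon form the coefficient at the head of a row is the coefficient of that
row. -/
theorem IsEchelon.coeff_head_sum (hR : IsEchelon D hd R)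
    (hred : ∀ g ∈ R, ∀ f ∈ R, g ≠ f → hd f ∉ g.support)
    (c : MvPolynomial (Fin n) K → K) {r : MvPolynomial (Fin n) K} (hr : r ∈ R) :
    coeff (hd r) (∑ b ∈ R, c b • b) = c r := by
  rw [coeff_sum, Finset.sum_eq_single r]
  · rw [coeff_smul, hR.monic r hr, smul_eq_mul, mul_one]
  · intro b hb hbr
    rw [coeff_smul, notMem_support_iff.1 (hred b hb r hr hbr), smul_zero]
  · exact fun h => absurd hr h

/-- If the columns of `O` are to the right of all others, a row with head in `O` is supported
on `O`. -/
theorem mem_restrictSupport_of_head_mem {cols : List (Fin n →₀ ℕ)}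
    (hcols : cols.Pairwise fun a b => a ∈ O → b ∈ O) {r : MvPolynomial (Fin n) K}
    (hr : r ∈ restrictSupport K {t | t ∈ cols}) (h : head cols r ∈ O) :
    r ∈ restrictSupport K (O : Set (Fin n →₀ ℕ)) := by
  intro t ht
  have htc : t ∈ cols := hr ht
  have h0 : r ≠ 0 := by rintro rfl; simp at ht
  have hhc : head cols r ∈ cols := hr ((isHead_head cols).mem_support r hr h0)
  have hle := (isHead_head cols).le_head r hr t ht
  have h1 := List.idxOf_lt_length_of_mem htc
  have h2 := List.idxOf_lt_length_of_mem hhc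
  rcases eq_or_ne (cols.idxOf (head cols r)) (cols.idxOf t) with he | hne
  · rw [← (List.idxOf_inj hhc).1 he]; exact h
  · have := List.pairwise_iff_getElem.1 hcols _ _ h2 h1 (by simp only [rank] at hle; omega)
    rw [List.getElem_idxOf, List.getElem_idxOf] at this
    exact this h

/-- The rows of the reduced row echelon form with head in the border are the border basis. -/
theorem filter_head_eq_borderBasis {G : Finset (MvPolynomial (Fin n) K)}
    (hG : IsBorderBasis I O G) {cols : List (Fin n →₀ ℕ)}
    (hcols : cols.Pairwise fun a b => a ∈ O → b ∈ O)
    (hR : IsEchelon {t | t ∈ cols} (head cols) R)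
    (hspan : Submodule.span K (R : Set (MvPolynomial (Fin n) K)) =
      I.restrictScalars K ⊓ degLT K n (O.card + 1))
    (hred : ∀ g ∈ R, ∀ f ∈ R, g ≠ f → head cols f ∉ g.support) :
    (R.filter fun g => head cols g ∈ border O) = G := by
  have hcompl := hG.isCompl_restrictSupport
  have hRO : ∀ r ∈ R, head cols r ∉ O := by
    intro r hr hrO
    have hrI : r ∈ I := (hspan.le (Submodule.subset_span hr)).1
    exact hR.ne_zero hr (eq_zero_of_isCompl hcompl hrI
      (mem_restrictSupport_of_head_mem hcols (hR.mem r hr) hrO))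
  have key : ∀ g ∈ I, ∀ b ∈ border O,
      monomial b 1 - g ∈ restrictSupport K (O : Set (Fin n →₀ ℕ)) →
      g ∈ R ∧ head cols g = b := by
    intro g hgI b hb hgb
    have hbO := notMem_of_mem_border hb
    have hcb : coeff b g = 1 := by
      have : b ∉ (monomial b (1 : K) - g).support := fun h => hbO (hgb h)
      rw [notMem_support_iff, coeff_sub, coeff_monomial, if_pos rfl, sub_eq_zero] at this
      exact this.symm
    have hsupp : ∀ t ∈ g.support, t = b ∨ t ∈ O := by
      intro t ht
      by_cases htb : t = b
      · exact Or.inl htb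
      · right
        have : t ∈ (monomial b (1 : K) - g).support := by
          rw [mem_support_iff, coeff_sub, coeff_monomial, if_neg (Ne.symm htb), zero_sub,
            neg_ne_zero]
          exact mem_support_iff.1 ht
        exact hgb this
    have hgspan : g ∈ Submodule.span K (R : Set (MvPolynomial (Fin n) K)) := by
      rw [hspan]
      refine ⟨hgI, mem_degLT.2 fun t ht => ?_⟩
      rcases hsupp t ht with rfl | htO
      · exact Nat.lt_succ_of_le (degree_le_of_mem_border hG.isOrderIdeal hb)
      · exact (hG.isOrderIdeal.degree_lt_card htO).trans (Nat.lt_succ_self _)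
    obtain ⟨c, rfl⟩ := exists_sum_of_mem_span hgspan
    have hhead : ∀ r ∈ R, c r ≠ 0 → head cols r = b := by
      intro r hr hcr
      refine (hsupp (head cols r) ?_).resolve_right (hRO r hr)
      rw [mem_support_iff, hR.coeff_head_sum hred c hr]
      exact hcr
    obtain ⟨r, hr, hcr⟩ : ∃ r ∈ R, c r ≠ 0 := by
      by_contra! hcon
      rw [Finset.sum_eq_zero fun r hr => by rw [hcon r hr, zero_smul]] at hcb
      simp at hcb
    have hrb := hhead r hr hcr
    have hcr1 : c r = 1 := by
      rw [← hR.coeff_head_sum hred c hr, hrb, hcb]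
    have hsum : ∑ b ∈ R, c b • b = r := by
      rw [Finset.sum_eq_single r, hcr1, one_smul]
      · intro r' hr' hne
        by_contra h0
        exact hne (hR.injOn hr' hr ((hhead r' hr' fun h => h0 (by rw [h, zero_smul])).trans
          hrb.symm))
      · exact fun h => absurd hr h
    rw [hsum]
    exact ⟨hr, hrb⟩
  ext g
  rw [Finset.mem_filter]
  constructor
  · rintro ⟨hg, hgb⟩
    obtain ⟨α, hα⟩ := hG.form
    obtain ⟨g', hg', hgb'⟩ : ∃ g' ∈ G, monomial (head cols g) 1 - g' ∈
        restrictSupport K (O : Set (Fin n →₀ ℕ)) := by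
      refine ⟨monomial (head cols g) 1 - ∑ t ∈ O, monomial t (α t (head cols g)), ?_, ?_⟩
      · rw [hα]
        classical
        exact Finset.mem_image_of_mem
          (fun b => monomial b (1 : K) - ∑ t ∈ O, monomial t (α t b)) hgb
      · rw [sub_sub_cancel]; exact sum_monomial_mem_restrictSupport _
    obtain ⟨h1, h2⟩ := key g' (hG.mem_iff.1 hg').1 _ hgb hgb'
    rwa [hR.injOn hg h1 h2.symm]
  · intro hg
    obtain ⟨hgI, b, hb, hgb⟩ := hG.mem_iff.1 hg
    obtain ⟨h1, h2⟩ := key g hgI b hb hgb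
    exact ⟨h1, h2 ▸ hb⟩

/-- The invariant of `BasisTransformation(M, O)` for a basis `M` of the elements of degree at most
`|O|` of the ideal `I`. -/
def TransInv (I : Ideal (MvPolynomial (Fin n) K)) (O : Finset (Fin n →₀ ℕ)) :
    TransState K n → Prop
  | .start M => Submodule.span K (M : Set (MvPolynomial (Fin n) K)) =
      I.restrictScalars K ⊓ degLT K n (O.card + 1)
  | .forward cols s => (cols.Pairwise fun a b => a ∈ O → b ∈ O) ∧
      ∃ M : Finset (MvPolynomial (Fin n) K),
        Submodule.span K (M : Set (MvPolynomial (Fin n) K)) =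
          I.restrictScalars K ⊓ degLT K n (O.card + 1) ∧
        GaussInv {t | t ∈ cols} (head cols) ∅ M s
  | .back cols R => (cols.Pairwise fun a b => a ∈ O → b ∈ O) ∧
      IsEchelon {t | t ∈ cols} (head cols) R ∧
      Submodule.span K (R : Set (MvPolynomial (Fin n) K)) =
        I.restrictScalars K ⊓ degLT K n (O.card + 1)
  | .ret G => IsBorderBasis I O G

theorem TransInv.step (hO : O ∈ admissible I) {s s' : TransState K n} (hs : TransInv I O s)
    (hstep : TransStep O s s') : TransInv I O s' := by
  classical
  cases hstep with
  | permute M cols hnd hcols hpw =>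
    refine ⟨hpw, M, hs, GaussInv.start IsEchelon.empty fun g hg t ht => ?_⟩
    rw [Set.mem_ofPred_eq, ← List.mem_toFinset, hcols]
    exact mem_termsLT.2 (Nat.lt_succ_of_le ((degree_le_totalDegree ht).trans
      (Finset.le_sup (f := totalDegree) hg)))
  | forward_step cols s s' h =>
    obtain ⟨h1, M, h2, h3⟩ := hs
    exact ⟨h1, M, h2, h3.step (isHead_head cols) h⟩
  | forward_ret cols s R h =>
    obtain ⟨h1, M, h2, h3⟩ := hs
    have h4 := h3.span_eq_of_returns h
    simp only [Finset.coe_empty, Submodule.span_empty, bot_sup_eq] at h4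
    have h5 := h3.echelon
    rw [h3.V_eq, h.2.2, Finset.empty_union] at h5
    exact ⟨h1, h5, h4.trans h2⟩
  | back_step cols R g f hg hf hne hfg =>
    obtain ⟨h1, h2, h3⟩ := hs
    obtain ⟨h4, h5, -⟩ := h2.back_step (isHead_head cols) hg hf hne hfg
    exact ⟨h1, h4, h5.trans h3⟩
  | back_ret cols R hred =>
    obtain ⟨h1, h2, h3⟩ := hs
    obtain ⟨G, hG⟩ := hO
    rw [TransInv, filter_head_eq_borderBasis hG h1 h2 h3 hred]
    exact hG

theorem TransInv.acc (hO : O ∈ admissible I) {s : TransState K n} (hs : TransInv I O s) :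
    Acc (fun a b => TransStep O b a) s := by
  classical
  have hret : ∀ G : Finset (MvPolynomial (Fin n) K), Acc (fun a b => TransStep O b a) (.ret G) :=
    fun G => ⟨_, fun s' h => by cases h⟩
  have hback : ∀ cols (R : Finset (MvPolynomial (Fin n) K)), TransInv I O (.back cols R) →
      Acc (fun a b => TransStep O b a) (.back cols R) := by
    intro cols R hs
    induction hk : ∑ r ∈ R, weight (rank cols) r using Nat.strong_induction_on generalizing R with
    | _ k ih =>
      refine ⟨_, fun s' hstep => ?_⟩
      have hs' := hs.step hO hstep
      cases hstep with
      | back_step _ _ g f hg hf hne hfg =>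
        refine ih _ ?_ _ hs' rfl
        rw [← hk]
        exact (hs.2.1.back_step (isHead_head cols) hg hf hne hfg).2.2
      | back_ret _ _ _ => exact hret _
  have hforward : ∀ cols (s : GaussState K n), TransInv I O (.forward cols s) →
      Acc (fun a b => TransStep O b a) (.forward cols s) := by
    intro cols s hs
    obtain ⟨-, M, -, hg⟩ := id hs
    have hacc := hg.acc (isHead_head cols)
    clear hg
    induction hacc with
    | intro s _ ih =>
      refine ⟨_, fun s' hstep => ?_⟩
      have hs' := hs.step hO hstep
      cases hstep with
      | forward_step _ _ s' h => exact ih s' h hs'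
      | forward_ret _ _ R h => exact hback _ _ hs'
  cases s with
  | ret G => exact hret G
  | back cols R => exact hback cols R hs
  | forward cols s => exact hforward cols s hs
  | start M =>
    refine ⟨_, fun s' hstep => ?_⟩
    have hs' := hs.step hO hstep
    cases hstep with
    | permute _ cols h1 h2 h3 => exact hforward _ _ hs'

theorem TransState.exists_step_or_ret (O : Finset (Fin n →₀ ℕ)) (s : TransState K n) :
    (∃ s', TransStep O s s') ∨ ∃ G, s = .ret G := by
  classical
  cases s with
  | ret G => exact Or.inr ⟨G, rfl⟩
  | start M =>
    left
    set T := termsLE n (M.sup totalDegree) with hT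
    refine ⟨_, .permute M ((T.filter fun t => t ∉ O).toList ++ (T.filter fun t => t ∈ O).toList)
      ?_ ?_ ?_⟩
    · refine List.nodup_append.2 ⟨Finset.nodup_toList _, Finset.nodup_toList _, ?_⟩
      intro a ha b hb hab
      rw [Finset.mem_toList, Finset.mem_filter] at ha hb
      exact ha.2 (hab ▸ hb.2)
    · ext t
      simp only [List.toFinset_append, Finset.toList_toFinset, Finset.mem_union,
        Finset.mem_filter]
      tauto
    · refine List.pairwise_append.2 ⟨List.Pairwise.imp_of_mem (R := fun _ _ => True) ?_ ?_,
        List.Pairwise.imp_of_mem (R := fun _ _ => True) ?_ ?_, ?_⟩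
      · intro a b ha _ _ haO
        rw [Finset.mem_toList, Finset.mem_filter] at ha
        exact absurd haO ha.2
      · exact List.pairwise_of_forall fun _ _ => trivial
      · intro a b _ hb _ _
        rw [Finset.mem_toList, Finset.mem_filter] at hb
        exact hb.2
      · exact List.pairwise_of_forall fun _ _ => trivial
      · intro a ha b _ haO
        rw [Finset.mem_toList, Finset.mem_filter] at ha
        exact absurd haO ha.2
  | forward cols s =>
    left
    rcases s.exists_step_or_returns (head cols) with ⟨s', h⟩ | ⟨W, h⟩
    · exact ⟨_, .forward_step cols s s' h⟩
    · exact ⟨_, .forward_ret cols s W h⟩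
  | back cols R =>
    left
    by_cases hred : ∀ g ∈ R, ∀ h ∈ R, g ≠ h → head cols h ∉ g.support
    · exact ⟨_, .back_ret cols R hred⟩
    · push Not at hred
      obtain ⟨g, hg, f, hf, hne, hfg⟩ := hred
      exact ⟨_, .back_step cols R g f hg hf hne hfg⟩

end Trans

section Polytope

variable {K : Type*} [Field K] {n : ℕ} {I : Ideal (MvPolynomial (Fin n) K)} {d : ℕ}
  {M : Finset (MvPolynomial (Fin n) K)}

/-! ### The order ideal polytope -/

/-- The column of the coefficient matrix of `M` that belongs to a term. -/
noncomputable def column (d : ℕ) (M : Finset (MvPolynomial (Fin n) K)) (u : termsLT n d) :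
    M → K := fun g => coeff u.1 (g : MvPolynomial (Fin n) K)

theorem rank_eq_finrank_span_image (U : Finset (termsLT n d)) :
    (Matrix.of fun (g : M) (u : U) =>
      coeff (u : termsLT n d).1 (g : MvPolynomial (Fin n) K)).rank =
    Module.finrank K (Submodule.span K (column d M '' (U : Set (termsLT n d)))) := by
  have hcols : Set.range (Matrix.of fun (g : M) (u : U) =>
      coeff (u : termsLT n d).1 (g : MvPolynomial (Fin n) K)).col =
      column d M '' (U : Set (termsLT n d)) := by
    ext v
    constructor
    · rintro ⟨u, rfl⟩
      exact ⟨u.1, u.2, rfl⟩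
    · rintro ⟨u, hu, rfl⟩
      exact ⟨⟨u, hu⟩, rfl⟩
  rw [Matrix.rank_eq_finrank_span_cols, hcols]

theorem linearIndepOn_column_iff (C : Finset (termsLT n d)) :
    LinearIndepOn K (column d M) (C : Set (termsLT n d)) ↔
      C.card ≤ (Matrix.of fun (g : M) (u : C) =>
      coeff (u : termsLT n d).1 (g : MvPolynomial (Fin n) K)).rank := by
  rw [rank_eq_finrank_span_image, LinearIndepOn, linearIndependent_iff_card_le_finrank_span,
    Set.finrank, Set.range_comp', Subtype.range_coe]
  simp

/-- A space with basis `M` meets the polynomials supported on a set of terms trivially iff the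
columns outside this set, if as many as the rows, are linearly independent. -/
theorem disjoint_iff_linearIndepOn_column
    (hM : LinearIndepOn K id (M : Set (MvPolynomial (Fin n) K)))
    (hMd : Submodule.span K (M : Set (MvPolynomial (Fin n) K)) ≤ degLT K n d)
    (O : Finset (Fin n →₀ ℕ)) (C : Finset (termsLT n d)) (hC : ∀ a, a ∈ C ↔ a.1 ∉ O)
    (hcard : C.card = M.card) :
    Disjoint (Submodule.span K (M : Set (MvPolynomial (Fin n) K)))
      (restrictSupport K (O : Set (Fin n →₀ ℕ))) ↔
    LinearIndepOn K (column d M) (C : Set (termsLT n d)) := by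
  classical
  rw [linearIndepOn_column_iff]
  set A := Matrix.of fun (g : M) (u : C) =>
      coeff (u : termsLT n d).1 (g : MvPolynomial (Fin n) K) with hA
  have hrow : LinearIndependent K A.row ↔ C.card ≤ A.rank := by
    rw [linearIndependent_iff_card_le_finrank_span, Matrix.rank_eq_finrank_span_row, hcard,
      Fintype.card_coe]
    rfl
  rw [← hrow, Fintype.linearIndependent_iff]
  have hsum : ∀ (c : M → K) (u : C),
      (∑ g, c g • A.row g) u =
        coeff (u : termsLT n d).1 (∑ g, c g • (g : MvPolynomial (Fin n) K)) := by
    intro c u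
    rw [Finset.sum_apply, coeff_sum]
    rfl
  have hspan : ∀ c : M → K, ∑ g, c g • (g : MvPolynomial (Fin n) K) ∈
      Submodule.span K (M : Set (MvPolynomial (Fin n) K)) := fun c =>
    Submodule.sum_mem _ fun g _ => Submodule.smul_mem _ _ (Submodule.subset_span g.2)
  rw [Submodule.disjoint_def]
  constructor
  · intro h c hc
    have h0 := h _ (hspan c) (by
      intro t ht
      by_contra htO
      have htd := hMd (hspan c) ht
      have htC : (⟨t, htd⟩ : termsLT n d) ∈ C := (hC _).2 htO
      have := hsum c ⟨_, htC⟩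
      rw [hc] at this
      exact mem_support_iff.1 ht this.symm)
    exact Fintype.linearIndependent_iff.1 hM c h0
  · intro h p hp hpO
    obtain ⟨c, rfl⟩ := exists_sum_of_mem_span hp
    rw [← Finset.sum_coe_sort M fun b => c b • b] at hpO ⊢
    have h0 := h (fun g => c g) (funext fun u => by
      rw [hsum (fun g => c g) u]
      by_contra hne
      exact (hC _).1 u.2 (hpO (mem_support_iff.2 hne)))
    exact Finset.sum_eq_zero fun g _ => by rw [h0 g, zero_smul]

/-- As many terms as the colength of `I` span a complement of `I` as soon as they are linearly
independent modulo `I`. -/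
theorem isCompl_of_disjoint {O : Finset (Fin n →₀ ℕ)}
    (hfin : FiniteDimensional K (MvPolynomial (Fin n) K ⧸ I))
    (h : Disjoint (I.restrictScalars K) (restrictSupport K (O : Set (Fin n →₀ ℕ))))
    (hcard : O.card = Module.finrank K (MvPolynomial (Fin n) K ⧸ I)) :
    IsCompl (I.restrictScalars K) (restrictSupport K (O : Set (Fin n →₀ ℕ))) := by
  refine ⟨h, codisjoint_iff.2 (eq_top_iff.2 fun p _ => ?_)⟩
  set q := (Ideal.Quotient.mkₐ K I).toLinearMap.domRestrict
    (restrictSupport K (O : Set (Fin n →₀ ℕ))) with hq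
  have hinj : Function.Injective q := by
    rw [injective_iff_map_eq_zero]
    rintro ⟨r, hr⟩ h0
    exact Subtype.ext (Submodule.disjoint_def.1 h r (Ideal.Quotient.eq_zero_iff_mem.1 h0) hr)
  have hsurj : Function.Surjective q :=
    (LinearMap.injective_iff_surjective_of_finrank_eq_finrank
      ((finrank_restrictSupport O).trans hcard)).1 hinj
  obtain ⟨⟨r, hr⟩, hpr⟩ := hsurj (Ideal.Quotient.mk I p)
  rw [← sub_add_cancel p r]
  exact Submodule.add_mem_sup (Ideal.Quotient.eq.1 (Eq.symm hpr)) hr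

theorem disjoint_ideal_iff {O : Finset (Fin n →₀ ℕ)} (hO : ∀ t ∈ O, t.degree < d)
    (hspan : Submodule.span K (M : Set (MvPolynomial (Fin n) K)) =
      I.restrictScalars K ⊓ degLT K n d) :
    Disjoint (I.restrictScalars K) (restrictSupport K (O : Set (Fin n →₀ ℕ))) ↔
    Disjoint (Submodule.span K (M : Set (MvPolynomial (Fin n) K)))
      (restrictSupport K (O : Set (Fin n →₀ ℕ))) := by
  have hle : restrictSupport K (O : Set (Fin n →₀ ℕ)) ≤ degLT K n d :=
    fun p hp => mem_degLT.2 fun t ht => hO t (hp ht)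
  rw [hspan, disjoint_iff, disjoint_iff, inf_assoc, inf_eq_right.2 hle]

/-- The admissible order ideals are given by the integral points of the order ideal polytope. -/
theorem mem_admissible_iff_exists_point
    (hfin : FiniteDimensional K (MvPolynomial (Fin n) K ⧸ I))
    (hd : d = Module.finrank K (MvPolynomial (Fin n) K ⧸ I))
    (hM : LinearIndepOn K id (M : Set (MvPolynomial (Fin n) K)))
    (hspan : Submodule.span K (M : Set (MvPolynomial (Fin n) K)) =
      I.restrictScalars K ⊓ degLT K n d)
    (O : Finset (Fin n →₀ ℕ)) :
    O ∈ admissible I ↔ ∃ z ∈ polytopeIntegralPoints d M, termsOfPoint z = O := by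
  classical
  have hMd : Submodule.span K (M : Set (MvPolynomial (Fin n) K)) ≤ degLT K n d :=
    hspan.le.trans inf_le_right
  have hdim : d + M.card = (termsLT n d).card := by
    have h1 := finrank_quotient_add_finrank (e := d) (hd ▸ sup_degLT_finrank_eq_top hfin)
    rw [← hspan, finrank_span_finset_eq_card hM, ← hd] at h1
    exact h1
  have hfilter : ∀ O' : Finset (termsLT n d), O'.card = d →
      (Finset.univ.filter fun a => a ∉ O').card = M.card := by
    intro O' hO'
    have h1 := Finset.card_filter_add_card_filter_not (s := (Finset.univ : Finset (termsLT n d)))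
      (fun a => a ∈ O')
    rw [Finset.filter_univ_mem, hO', Finset.card_univ, Fintype.card_coe] at h1
    omega
  constructor
  · intro hO
    rw [mem_admissible_iff] at hO
    obtain ⟨hOI, hc⟩ := hO
    have hOd : O.card = d := (card_of_isCompl hc).trans hd.symm
    have hOdeg : ∀ t ∈ O, t.degree < d := fun t ht => hOd ▸ hOI.degree_lt_card ht
    set O' : Finset (termsLT n d) := Finset.univ.filter fun a => a.1 ∈ O with hO'
    have hmap : O'.map (Function.Embedding.subtype _) = O := by
      ext t
      simp only [Finset.mem_map, hO', Finset.mem_filter, Finset.mem_univ, true_and,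
        Function.Embedding.subtype_apply]
      exact ⟨by rintro ⟨a, ha, rfl⟩; exact ha,
        fun ht => ⟨⟨t, mem_termsLT.2 (hOdeg t ht)⟩, ht, rfl⟩⟩
    have hO'd : O'.card = d := by
      rw [← Finset.card_map (Function.Embedding.subtype _), hmap, hOd]
    set z : termsLT n d → ℝ := fun a => if a.1 ∈ O then 1 else 0 with hz
    have hsumz : ∀ U : Finset (termsLT n d),
        ∑ a ∈ U, z a = ((U.filter fun a => a.1 ∈ O).card : ℝ) := by
      intro U
      rw [hz, Finset.sum_boole]
    have hli := (disjoint_iff_linearIndepOn_column hM hMd O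
      (Finset.univ.filter fun a => a ∉ O') (fun a => by simp [hO']) (hfilter O' hO'd)).1
      ((disjoint_ideal_iff hOdeg hspan).1 hc.disjoint)
    refine ⟨z, ⟨?_, ?_, ?_, ?_, ?_⟩, ?_⟩
    · intro a b hab
      simp only [hz]
      split_ifs with hb ha ha
      · exact le_rfl
      · exact absurd (hOI _ hb _ hab) ha
      · exact zero_le_one
      · exact le_rfl
    · rw [hsumz, ← hO', hO'd]
    · intro U hU
      rw [hsumz, sub_le_iff_le_add, ← Nat.cast_add, Nat.cast_le]
      have hsub : LinearIndepOn K (column d M)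
          ((U.filter fun a => a.1 ∉ O : Finset _) : Set (termsLT n d)) := by
        refine hli.mono fun a ha => ?_
        simp only [Finset.coe_filter, Set.mem_ofPred_eq, hO', Finset.mem_filter, Finset.mem_univ,
          true_and] at ha ⊢
        exact ha.2
      have h1 := (linearIndepOn_column_iff _).1 hsub
      -- the independent columns of `U` outside `O` bound the rank from below
      have h2 : (U.filter fun a => a.1 ∉ O).card ≤ (Matrix.of fun (g : M) (u : U) =>
          coeff (u : termsLT n d).1 (g : MvPolynomial (Fin n) K)).rank := by
        refine h1.trans ?_
        rw [rank_eq_finrank_span_image, rank_eq_finrank_span_image]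
        refine Submodule.finrank_mono (Submodule.span_mono (Set.image_mono ?_))
        exact_mod_cast Finset.filter_subset _ _
      have h3 := Finset.card_filter_add_card_filter_not (s := U) (fun a => a.1 ∈ O)
      omega
    · intro a
      simp only [hz]
      split_ifs <;> norm_num
    · intro a
      by_cases ha : a.1 ∈ O
      · exact ⟨1, by simp [hz, ha]⟩
      · exact ⟨0, by simp [hz, ha]⟩
    · rw [← hmap, termsOfPoint]
      congr 1
      ext a
      simp [hz, hO']
  · rintro ⟨z, ⟨hmono, hsum, hrank, h01, hint⟩, rfl⟩
    have hz : ∀ a, z a = if z a = 1 then 1 else 0 := by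
      intro a
      obtain ⟨k, hk⟩ := hint a
      have h1 := h01 a
      rw [hk] at h1 ⊢
      have h2 : 0 ≤ k := by exact_mod_cast h1.1
      have h3 : k ≤ 1 := by exact_mod_cast h1.2
      interval_cases k <;> norm_num
    set O' : Finset (termsLT n d) := Finset.univ.filter fun a => z a = 1 with hO'
    have hsumz : ∀ U : Finset (termsLT n d),
        ∑ a ∈ U, z a = ((U.filter fun a => z a = 1).card : ℝ) := by
      intro U
      rw [← Finset.sum_boole]
      exact Finset.sum_congr rfl fun a _ => hz a
    have hO'd : O'.card = d := by
      rw [hsumz] at hsum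
      exact_mod_cast hsum
    have hterms : termsOfPoint z = O'.map (Function.Embedding.subtype _) := by
      rw [termsOfPoint, hO']
    have hmem : ∀ a : termsLT n d, a.1 ∈ termsOfPoint z ↔ z a = 1 := by
      intro a
      rw [hterms]
      simp [hO']
    have hdeg : ∀ t ∈ termsOfPoint z, t.degree < d := by
      intro t ht
      rw [hterms, Finset.mem_map] at ht
      obtain ⟨a, -, rfl⟩ := ht
      exact mem_termsLT.1 a.2
    have hcard : (termsOfPoint z).card = d := by rw [hterms, Finset.card_map, hO'd]
    refine mem_admissible_iff.2 ⟨fun t ht t' hle => ?_, ?_⟩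
    · have ht' : t'.degree < d := (Finsupp.degree_mono hle).trans_lt (hdeg t ht)
      have h1 := (hmem ⟨t, mem_termsLT.2 (hdeg t ht)⟩).1 ht
      have h2 := hmono ⟨t', mem_termsLT.2 ht'⟩ ⟨t, mem_termsLT.2 (hdeg t ht)⟩ hle
      rw [h1] at h2
      exact (hmem ⟨t', mem_termsLT.2 ht'⟩).2 (le_antisymm (h01 _).2 h2)
    · -- the rank condition for the set of all columns outside `O`
      refine isCompl_of_disjoint hfin ((disjoint_ideal_iff hdeg hspan).2 ?_) (hcard.trans hd)
      refine (disjoint_iff_linearIndepOn_column hM hMd _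
        (Finset.univ.filter fun a => a ∉ O') (fun a => by simp [hO', hmem]) (hfilter O' hO'd)).2 ?_
      rw [linearIndepOn_column_iff]
      have h1 := hrank _ (hfilter O' hO'd)
      have hempty : ((Finset.univ.filter fun a => a ∉ O').filter fun a => z a = 1) = ∅ := by
        ext a
        simp [hO']
      rw [hsumz, hempty] at h1
      rw [Finset.card_empty, Nat.cast_zero, sub_nonpos, Nat.cast_le] at h1
      exact h1

end Polytope

section Alg

variable {K : Type*} [Field K] {n : ℕ} {σ : MonomialOrder (Fin n)}
  {F : Finset (MvPolynomial (Fin n) K)} {I : Ideal (MvPolynomial (Fin n) K)}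

/-! ### The generalized border basis algorithm -/

/-- The invariant of the algorithm. -/
def AlgInv (σ : MonomialOrder (Fin n)) (F : Finset (MvPolynomial (Fin n) K))
    (I : Ideal (MvPolynomial (Fin n) K)) : AlgState K n → Prop
  | .span d s => (∀ f ∈ F, f.totalDegree ≤ d) ∧ StabInv σ F d s
  | .test d M => (∀ f ∈ F, f.totalDegree ≤ d) ∧ StabInv σ F d (.ret M)
  | .adjust d M => (∀ f ∈ F, f.totalDegree ≤ d) ∧ StabInv σ F d (.ret M) ∧
      ∀ t : Fin n →₀ ℕ, t.degree = d → t ∈ leadingTerms σ (stableSpan F d)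
  | .respan d s => (∀ f ∈ F, f.totalDegree ≤ d) ∧ StabInv σ F d s ∧
      (∀ t : Fin n →₀ ℕ, t.degree = d → t ∈ leadingTerms σ (stableSpan F d)) ∧
      d = Module.finrank K (MvPolynomial (Fin n) K ⧸ I)
  | .choose d M => d = Module.finrank K (MvPolynomial (Fin n) K ⧸ I) ∧
      IsEchelon Set.univ σ.degree M ∧
      Submodule.span K (M : Set (MvPolynomial (Fin n) K)) =
        I.restrictScalars K ⊓ degLT K n (d + 1)
  | .transform O s => O ∈ admissible I ∧ TransInv I O s
  | .done O G => O ∈ admissible I ∧ IsBorderBasis I O G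

theorem topCovered_iff {d : ℕ} {M : Finset (MvPolynomial (Fin n) K)}
    (hM : StabInv σ F d (.ret M)) :
    TopCovered σ d M ↔
      ∀ t : Fin n →₀ ℕ, t.degree = d → t ∈ leadingTerms σ (stableSpan F d) := by
  constructor
  · intro h t ht
    obtain ⟨g, hg, h0, hgt⟩ := h t ht
    exact ⟨g, hM.2 ▸ Submodule.subset_span hg, h0, hgt⟩
  · intro h t ht
    obtain ⟨g, hg, h0, hgt⟩ := h t ht
    rw [← hM.2] at hg
    obtain ⟨b, hb, hbg⟩ := hM.1.exists_head_of_mem_span (isHead_degree σ) hg h0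
    exact ⟨b, hb, hM.1.ne_zero hb, hbg.trans hgt⟩

/-- The number computed in the adjustment step is the colength of the ideal. -/
theorem card_sub_card_eq (hσ : DegCompat σ)
    (hI : I = Ideal.span (F : Set (MvPolynomial (Fin n) K))) {d : ℕ}
    {M : Finset (MvPolynomial (Fin n) K)} (hs : AlgInv σ F I (.adjust d M)) :
    (termsLE n d).card - M.card = Module.finrank K (MvPolynomial (Fin n) K ⧸ I) := by
  obtain ⟨hF, ⟨hM, hMs⟩, hcov⟩ := hs
  have h1 := finrank_quotient_add_finrank_stableSpan hσ hF hI hcov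
  rw [← hMs, hM.finrank_span (isHead_degree σ)] at h1
  omega

theorem span_eq_of_choose (hσ : DegCompat σ)
    (hfin : FiniteDimensional K (MvPolynomial (Fin n) K ⧸ I)) {d : ℕ}
    {M : Finset (MvPolynomial (Fin n) K)} (hs : AlgInv σ F I (.choose d M)) :
    Ideal.span (M : Set (MvPolynomial (Fin n) K)) = I := by
  obtain ⟨rfl, -, h⟩ := hs
  exact ideal_span_eq hσ hfin h

theorem AlgInv.start : AlgInv σ F I (AlgState.start F) :=
  ⟨fun _ hf => Finset.le_sup (f := totalDegree) hf, StabInv.start⟩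

theorem AlgInv.step (hσ : DegCompat σ) (hI : I = Ideal.span (F : Set (MvPolynomial (Fin n) K)))
    (hfin : FiniteDimensional K (MvPolynomial (Fin n) K ⧸ I)) {s s' : AlgState K n}
    (hs : AlgInv σ F I s) (hstep : AlgStep σ F s s') : AlgInv σ F I s' := by
  cases hstep with
  | span_step d s s' h => exact ⟨hs.1, hs.2.step hσ h⟩
  | span_ret d M => exact hs
  | test_fail d M h => exact ⟨fun f hf => (hs.1 f hf).trans (Nat.le_succ d), StabInv.start⟩
  | test_pass d M h => exact ⟨hs.1, hs.2, (topCovered_iff hs.2).1 h⟩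
  | adjust_le e d M hd hle =>
    have hδ := hd.trans (card_sub_card_eq hσ hI hs)
    obtain ⟨hF, ⟨hM, hMs⟩, hcov⟩ := hs
    refine ⟨hδ, hM.mono (Finset.filter_subset _ _), ?_⟩
    have h1 := hM.span_filter hσ (d + 1)
    simp only [Nat.lt_succ_iff] at h1
    rw [h1, hMs, stableSpan_eq hσ hF hI hcov, inf_assoc,
      inf_eq_right.2 (degLT_mono (Nat.succ_le_succ hle))]
  | adjust_gt e d M hd hlt =>
    have hδ := hd.trans (card_sub_card_eq hσ hI hs)
    obtain ⟨hF, -, hcov⟩ := hs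
    refine ⟨fun f hf => (hF f hf).trans hlt.le, StabInv.start, ?_, hδ⟩
    exact leadingTerms_stableSpan_of_le hσ hlt.le fun t ht =>
      leadingTerms_mono σ (stableSpan_mono hlt.le) (hcov t ht)
  | respan_step d s s' h => exact ⟨hs.1, hs.2.1.step hσ h, hs.2.2⟩
  | respan_ret d M =>
    obtain ⟨hF, ⟨hM, hMs⟩, hcov, hδ⟩ := hs
    exact ⟨hδ, hM, hMs.trans (stableSpan_eq hσ hF hI hcov)⟩
  | choose d M O hO =>
    have hO' : O ∈ admissible I := by rwa [span_eq_of_choose hσ hfin hs] at hO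
    obtain ⟨hδ, -, hMs⟩ := hs
    refine ⟨hO', ?_⟩
    rw [TransInv, hMs, hδ, card_of_isCompl (mem_admissible_iff.1 hO').2]
  | transform_step O s s' h => exact ⟨hs.1, hs.2.step hs.1 h⟩
  | transform_ret O G => exact hs

theorem AlgInv.of_reachable (hσ : DegCompat σ)
    (hI : I = Ideal.span (F : Set (MvPolynomial (Fin n) K)))
    (hfin : FiniteDimensional K (MvPolynomial (Fin n) K ⧸ I)) {s : AlgState K n}
    (h : Reachable σ F s) : AlgInv σ F I s := by
  induction h with
  | refl => exact AlgInv.start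
  | tail _ hstep ih => exact ih.step hσ hI hfin hstep

theorem AlgInv.acc (hσ : DegCompat σ) (hI : I = Ideal.span (F : Set (MvPolynomial (Fin n) K)))
    (hfin : FiniteDimensional K (MvPolynomial (Fin n) K ⧸ I)) {s : AlgState K n}
    (hs : AlgInv σ F I s) : Acc (fun a b => AlgStep σ F b a) s := by
  have hdone : ∀ O G, Acc (fun a b => AlgStep σ F b a) (.done O G) :=
    fun O G => ⟨_, fun s' h => by cases h⟩
  have htransform : ∀ O s, AlgInv σ F I (.transform O s) →
      Acc (fun a b => AlgStep σ F b a) (.transform O s) := by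
    intro O s hs
    have hacc := hs.2.acc hs.1
    clear hs
    induction hacc with
    | intro s _ ih =>
      refine ⟨_, fun s' hstep => ?_⟩
      cases hstep with
      | transform_step _ _ s' h => exact ih s' h
      | transform_ret _ G => exact hdone O G
  have hchoose : ∀ d M, AlgInv σ F I (.choose d M) →
      Acc (fun a b => AlgStep σ F b a) (.choose d M) := by
    intro d M hs
    refine ⟨_, fun s' hstep => ?_⟩
    have hs' := hs.step hσ hI hfin hstep
    cases hstep with
    | choose _ _ O hO => exact htransform O _ hs'
  have hrespan : ∀ d s, AlgInv σ F I (.respan d s) →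
      Acc (fun a b => AlgStep σ F b a) (.respan d s) := by
    intro d s hs
    have hacc := hs.2.1.acc hσ hs.1
    induction hacc with
    | intro s _ ih =>
      refine ⟨_, fun s' hstep => ?_⟩
      have hs' := hs.step hσ hI hfin hstep
      cases hstep with
      | respan_step _ _ s' h => exact ih s' h hs'
      | respan_ret _ M => exact hchoose d M hs'
  have hadjust : ∀ d M, AlgInv σ F I (.adjust d M) →
      Acc (fun a b => AlgStep σ F b a) (.adjust d M) := by
    intro d M hs
    refine ⟨_, fun s' hstep => ?_⟩
    have hs' := hs.step hσ hI hfin hstep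
    cases hstep with
    | adjust_le _ d _ _ _ => exact hchoose _ _ hs'
    | adjust_gt _ d _ _ _ => exact hrespan _ _ hs'
  obtain ⟨d₀, hd₀⟩ := exists_forall_leadingTerms_stableSpan hσ hI hfin
  -- the test fails only below `d₀`, so the main loop is left after finitely many rounds
  have htest : ∀ d M, AlgInv σ F I (.test d M) →
      (∀ s, d < d₀ → AlgInv σ F I (.span (d + 1) s) →
        Acc (fun a b => AlgStep σ F b a) (.span (d + 1) s)) →
      Acc (fun a b => AlgStep σ F b a) (.test d M) := by
    intro d M hs hnext
    refine ⟨_, fun s' hstep => ?_⟩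
    have hs' := hs.step hσ hI hfin hstep
    cases hstep with
    | test_pass _ _ _ => exact hadjust _ _ hs'
    | test_fail _ _ hfail =>
      refine hnext _ ?_ hs'
      by_contra hge
      exact hfail ((topCovered_iff hs.2).2 (hd₀ d (not_lt.1 hge)))
  have hspan : ∀ d s, AlgInv σ F I (.span d s) →
      Acc (fun a b => AlgStep σ F b a) (.span d s) := by
    intro d
    induction hk : d₀ - d using Nat.strong_induction_on generalizing d with
    | _ k ihk =>
      intro s hs
      have hacc := hs.2.acc hσ hs.1
      induction hacc with
      | intro s _ ih =>
        refine ⟨_, fun s' hstep => ?_⟩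
        have hs' := hs.step hσ hI hfin hstep
        cases hstep with
        | span_step _ _ s' h => exact ih s' h hs'
        | span_ret _ M => exact htest d M hs' fun s hlt => ihk _ (by omega) (d + 1) rfl s
  cases s with
  | span d s => exact hspan d s hs
  | test d M => exact htest d M hs fun s _ => hspan (d + 1) s
  | adjust d M => exact hadjust d M hs
  | respan d s => exact hrespan d s hs
  | choose d M => exact hchoose d M hs
  | transform O s => exact htransform O s hs
  | done O G => exact hdone O G

theorem AlgInv.exists_step_or_done (hσ : DegCompat σ)
    (hfin : FiniteDimensional K (MvPolynomial (Fin n) K ⧸ I)) {s : AlgState K n}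
    (hs : AlgInv σ F I s) : (∃ s', AlgStep σ F s s') ∨ ∃ O G, s = .done O G := by
  cases s with
  | done O G => exact Or.inr ⟨O, G, rfl⟩
  | span d s =>
    left
    rcases s.exists_step_or_ret σ d with ⟨s', h⟩ | ⟨M, rfl⟩
    · exact ⟨_, .span_step d s s' h⟩
    · exact ⟨_, .span_ret d M⟩
  | test d M =>
    left
    by_cases h : TopCovered σ d M
    · exact ⟨_, .test_pass d M h⟩
    · exact ⟨_, .test_fail d M h⟩
  | adjust e M =>
    left
    rcases le_or_gt ((termsLE n e).card - M.card) e with h | h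
    · exact ⟨_, .adjust_le e _ M rfl h⟩
    · exact ⟨_, .adjust_gt e _ M rfl h⟩
  | respan d s =>
    left
    rcases s.exists_step_or_ret σ d with ⟨s', h⟩ | ⟨M, rfl⟩
    · exact ⟨_, .respan_step d s s' h⟩
    · exact ⟨_, .respan_ret d M⟩
  | choose d M =>
    left
    obtain ⟨O, hO, -⟩ := exists_admissible σ hfin
    exact ⟨_, .choose d M O (by rwa [span_eq_of_choose hσ hfin hs])⟩
  | transform O s =>
    left
    rcases TransState.exists_step_or_ret O s with ⟨s', h⟩ | ⟨G, rfl⟩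
    · exact ⟨_, .transform_step O s s' h⟩
    · exact ⟨_, .transform_ret O G⟩

/-- If every state in `P` has a successor in `P` or in `Q`, then a finite process that starts in `P`
can reach `Q`. -/
theorem exists_reflTransGen_of_acc {S : Type*} {r : S → S → Prop} {P Q : S → Prop}
    (hstep : ∀ s, P s → ∃ s', r s s' ∧ (P s' ∨ Q s')) {s : S}
    (hacc : Acc (fun a b => r b a) s) (hs : P s) : ∃ t, Relation.ReflTransGen r s t ∧ Q t := by
  induction hacc with
  | intro s _ ih =>
    obtain ⟨s', hr, hP | hQ⟩ := hstep s hs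
    · obtain ⟨t, ht, hQ⟩ := ih s' hr hP
      exact ⟨t, .head hr ht, hQ⟩
    · exact ⟨s', .single hr, hQ⟩

/-- The algorithm always arrives at the choice of an order ideal. -/
theorem exists_reachable_choose (hσ : DegCompat σ)
    (hI : I = Ideal.span (F : Set (MvPolynomial (Fin n) K)))
    (hfin : FiniteDimensional K (MvPolynomial (Fin n) K ⧸ I)) :
    ∃ d M, Reachable σ F (.choose d M) := by
  let P : AlgState K n → Prop := fun s => AlgInv σ F I s ∧
    match s with
    | .span _ _ | .test _ _ | .adjust _ _ | .respan _ _ => True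
    | _ => False
  obtain ⟨t, ht, d, M, rfl⟩ := exists_reflTransGen_of_acc (P := P)
    (Q := fun s => ∃ d M, s = .choose d M) (r := AlgStep σ F) (fun s hs => by
      obtain ⟨s', hstep⟩ := (hs.1.exists_step_or_done hσ hfin).resolve_right (by
        rintro ⟨O, G, rfl⟩
        exact hs.2)
      have hs' := hs.1.step hσ hI hfin hstep
      refine ⟨s', hstep, ?_⟩
      cases hstep with
      | span_step d s s' h => exact Or.inl ⟨hs', trivial⟩
      | span_ret d M => exact Or.inl ⟨hs', trivial⟩
      | test_fail d M h => exact Or.inl ⟨hs', trivial⟩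
      | test_pass d M h => exact Or.inl ⟨hs', trivial⟩
      | adjust_le e d M hd hle => exact Or.inr ⟨_, _, rfl⟩
      | adjust_gt e d M hd hlt => exact Or.inl ⟨hs', trivial⟩
      | respan_step d s s' h => exact Or.inl ⟨hs', trivial⟩
      | respan_ret d M => exact Or.inr ⟨_, _, rfl⟩
      | choose d M O hO => exact hs.2.elim
      | transform_step O s s' h => exact hs.2.elim
      | transform_ret O G => exact hs.2.elim)
    (AlgInv.start.acc hσ hI hfin) ⟨AlgInv.start, trivial⟩
  exact ⟨d, M, ht⟩

theorem exists_done_of_transform (hσ : DegCompat σ)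
    (hI : I = Ideal.span (F : Set (MvPolynomial (Fin n) K)))
    (hfin : FiniteDimensional K (MvPolynomial (Fin n) K ⧸ I)) {O : Finset (Fin n →₀ ℕ)}
    {s : TransState K n} (hs : AlgInv σ F I (.transform O s)) :
    ∃ G, Relation.ReflTransGen (AlgStep σ F) (.transform O s) (.done O G) := by
  obtain ⟨t, ht, G, rfl⟩ := exists_reflTransGen_of_acc
    (P := fun s => AlgInv σ F I s ∧ ∃ u, s = .transform O u)
    (Q := fun s => ∃ G, s = .done O G) (r := AlgStep σ F) (fun s hs => by
      obtain ⟨hinv, u, rfl⟩ := hs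
      obtain ⟨s', hstep⟩ := (hinv.exists_step_or_done hσ hfin).resolve_right (by
        rintro ⟨O, G, h⟩
        cases h)
      have hs' := hinv.step hσ hI hfin hstep
      refine ⟨s', hstep, ?_⟩
      cases hstep with
      | transform_step O s s' h => exact Or.inl ⟨hs', _, rfl⟩
      | transform_ret O G => exact Or.inr ⟨_, rfl⟩)
    (hs.acc hσ hI hfin) ⟨hs, _, rfl⟩
  exact ⟨G, ht⟩

end Alg
end BorderBasis

theorem proposition4p4 {K : Type*} [Field K] {n : ℕ} (σ : MonomialOrder (Fin n))
    (hσ : ∀ a b : Fin n →₀ ℕ, a.degree < b.degree → σ.toSyn a < σ.toSyn b)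
    (F : Finset (MvPolynomial (Fin n) K)) (I : Ideal (MvPolynomial (Fin n) K))
    (hI : I = Ideal.span (F : Set (MvPolynomial (Fin n) K)))
    (hfin : FiniteDimensional K (MvPolynomial (Fin n) K ⧸ I)) :
    -- every run is finite
    BorderBasis.Terminates σ F ∧
    -- no run gets stuck: a configuration without successor is an output
    (∀ s, BorderBasis.Reachable σ F s →
      (∃ s', BorderBasis.AlgStep σ F s s') ∨ ∃ O G, s = .done O G) ∧
    -- whenever the order ideal is to be chosen, the possible choices are exactly `Λ(I)`, and these
    -- are the order ideals given by the integral points of the order ideal polytope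
    (∀ d M, BorderBasis.Reachable σ F (.choose d M) →
      d = Module.finrank K (MvPolynomial (Fin n) K ⧸ I) ∧
      Ideal.span (M : Set (MvPolynomial (Fin n) K)) = I ∧
      ∀ O, (BorderBasis.AlgStep σ F (.choose d M) (.transform O (.start M)) ↔
            O ∈ BorderBasis.admissible I) ∧
        (O ∈ BorderBasis.admissible I ↔
          ∃ z ∈ BorderBasis.polytopeIntegralPoints d (M.filter fun g => g.totalDegree < d),
            BorderBasis.termsOfPoint z = O)) ∧
    -- only admissible order ideals are ever chosen
    (∀ O G, BorderBasis.Reachable σ F (.done O G) → O ∈ BorderBasis.admissible I) ∧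
    -- for every admissible `O`, the runs that choose `O` output the unique `O`-border basis of `I`
    (∀ O ∈ BorderBasis.admissible I, ∃ G, BorderBasis.IsBorderBasis I O G ∧
      (∀ G', BorderBasis.IsBorderBasis I O G' → G' = G) ∧
      ∀ G', BorderBasis.Reachable σ F (.done O G') ↔ G' = G) := by
  have hinv : ∀ s, BorderBasis.Reachable σ F s → BorderBasis.AlgInv σ F I s :=
    fun s hs => BorderBasis.AlgInv.of_reachable hσ hI hfin hs
  refine ⟨BorderBasis.AlgInv.start.acc hσ hI hfin,
    fun s hs => (hinv s hs).exists_step_or_done hσ hfin, ?_, fun O G h => (hinv _ h).1, ?_⟩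
  · intro d M hM
    have hs := hinv _ hM
    have hspan := BorderBasis.span_eq_of_choose hσ hfin hs
    refine ⟨hs.1, hspan, fun O => ⟨⟨fun h => ?_, fun h => .choose d M O (hspan.symm ▸ h)⟩, ?_⟩⟩
    · cases h with
      | choose _ _ _ h => exact hspan ▸ h
    · obtain ⟨hd, hech, hMs⟩ := hs
      refine BorderBasis.mem_admissible_iff_exists_point hfin hd
        ((hech.mono (Finset.filter_subset _ _)).linearIndepOn (BorderBasis.isHead_degree σ)) ?_ O
      rw [hech.span_filter hσ d, hMs, inf_assoc,
        inf_eq_right.2 (BorderBasis.degLT_mono (Nat.le_succ d))]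
  · intro O hO
    obtain ⟨d, M, hM⟩ := BorderBasis.exists_reachable_choose hσ hI hfin
    have hspan := BorderBasis.span_eq_of_choose hσ hfin (hinv _ hM)
    have hT : BorderBasis.Reachable σ F (.transform O (.start M)) :=
      hM.tail (.choose d M O (hspan.symm ▸ hO))
    obtain ⟨G, hG⟩ := BorderBasis.exists_done_of_transform hσ hI hfin (hinv _ hT)
    have hR : BorderBasis.Reachable σ F (.done O G) := hT.trans hG
    have hGB := (hinv _ hR).2
    refine ⟨G, hGB, fun G' hG' => hGB.unique hG', fun G' => ⟨fun h => ?_, ?_⟩⟩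
    · exact hGB.unique (hinv _ h).2
    · rintro rfl
      exact hR
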